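/- Conventions. A graph may have loops and multiple edges and is regarded as a metric graph with all edges of length $1$. A graph is finite if it has finitely many vertices and edges. Morphisms of graphs map vertices to vertices and restrict to local isometries on edges (formally, they are maps of vertices and of oriented edges that respect initial vertices and reversal of orientation). A covering $X\to Y$ is a morphism that is surjective and maps, for each vertex $v$ of $X$, the oriented edges starting at $v$ bijectively onto the oriented edges starting at the image of $v$; $X$ covers $Y$ if a covering $X\to Y$ exists. A quasitree is a connected locally finite graph that is quasi-isometric to a tree. $\mathrm{Aut}(X)$ is the group of automorphisms of $X$, with the compact-open topology; $X$ is cocompact if there are only finitely many $\mathrm{Aut}(X)$-orbits of vertices and of edges. A uniform lattice in $\mathrm{Aut}(X)$ is a discrete subgroup $\Gamma\le\mathrm{Aut}(X)$ that acts properly and cocompactly on $X$. Theorem. There exist a cocompact quasitree $X$ and finite graphs $X_1$ and $X_2$ such that $X$ covers $X_1$ and $X$ covers $X_2$, but there is no finite graph $\hat X$ such that $X$ covers $\hat X$ and $\hat X$ covers both $X_1$ and $X_2$ (the compositions $X\to\hat X\to X_i$ are not required to be any prescribed coverings). Moreover, $X$, $X_1$, $X_2$ can be chosen so that, in addition, $\mathrm{Aut}(X)$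 contains no uniform lattice. -/

import Mathlib

/-- A graph in the sense of Serre; loops and multiple edges are allowed. `E` is the set of oriented
edges, `src e` is the initial vertex of `e` and `inv e` is `e` with the opposite orientation, so that
the (unoriented) edges are the pairs `{e, inv e}`; a loop contributes two oriented edges at its
vertex. Such a graph is regarded as a metric graph with all edges of length one. -/
structure SerreGraph where
  V : Type
  E : Type
  src : E → V
  inv : E → E
  inv_inv : ∀ e, inv (inv e) = e
  inv_ne : ∀ e, inv e ≠ e

namespace SerreGraph

/-- The terminal vertex of an oriented edge. -/
def tgt (X : SerreGraph) (e : X.E) : X.V := X.src (X.inv e)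

/-- The set of oriented edges issuing from a vertex. -/
def starAt (X : SerreGraph) (v : X.V) : Set X.E := {e | X.src e = v}

/-- A finite graph: finitely many vertices and edges. -/
def IsFinite (X : SerreGraph) : Prop := Finite X.V ∧ Finite X.E

/-- Every vertex has finite valence. -/
def LocallyFinite (X : SerreGraph) : Prop := ∀ v : X.V, (X.starAt v).Finite

/-- A morphism of graphs: it maps vertices to vertices and oriented edges to oriented edges,
respecting initial vertices and orientation reversal (hence also terminal vertices). -/
structure Hom (X Y : SerreGraph) where
  onV : X.V → Y.V
  onE : X.E → Y.E
  src_onE : ∀ e, Y.src (onE e) = onV (X.src e)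
  inv_onE : ∀ e, Y.inv (onE e) = onE (X.inv e)

/-- A covering map: surjective, and a bijection from the star of each vertex onto the star
of its image. -/
def Hom.IsCovering {X Y : SerreGraph} (f : Hom X Y) : Prop :=
  Function.Surjective f.onV ∧ ∀ v : X.V, Set.BijOn f.onE (X.starAt v) (Y.starAt (f.onV v))

/-- `X` covers `Y`. -/
def Covers (X Y : SerreGraph) : Prop := ∃ f : Hom X Y, f.IsCovering

/-- The simple graph on the same vertices, in which distinct vertices are adjacent iff some edge
joins them. It has the same connectedness and the same path metric on vertices as the graph. -/
def toSimple (X : SerreGraph) : SimpleGraph X.V where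
  Adj u v := u ≠ v ∧ ∃ e, X.src e = u ∧ X.tgt e = v
  symm := ⟨fun u v h => by
    obtain ⟨hne, e, h1, h2⟩ := h
    exact ⟨hne.symm, X.inv e, h2, by rw [tgt, X.inv_inv, h1]⟩⟩
  loopless := ⟨fun _ h => h.1 rfl⟩

end SerreGraph

/-- `f` is a quasi-isometry between the vertex sets of two connected graphs, with their path metrics
(a connected metric graph is within distance one half of its vertex set). -/
def IsGraphQuasiIsometry {V W : Type} (G : SimpleGraph V) (H : SimpleGraph W) (f : V → W) : Prop :=
  ∃ K C : ℝ, 1 ≤ K ∧ 0 ≤ C ∧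
    (∀ x y : V, (G.dist x y : ℝ) / K - C ≤ (H.dist (f x) (f y) : ℝ) ∧
      (H.dist (f x) (f y) : ℝ) ≤ K * (G.dist x y : ℝ) + C) ∧
    ∀ w : W, ∃ x : V, (H.dist (f x) w : ℝ) ≤ C

namespace SerreGraph

/-- A quasitree: a connected locally finite graph that is quasi-isometric to a tree. -/
def IsQuasitree (X : SerreGraph) : Prop :=
  X.LocallyFinite ∧ X.toSimple.Connected ∧
    ∃ (W : Type) (T : SimpleGraph W), T.IsTree ∧
      ∃ f : X.V → W, IsGraphQuasiIsometry X.toSimple T f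

/-- The automorphism group: pairs of permutations of the vertices and of the oriented edges that
respect initial vertices and orientation reversal. -/
def Aut (X : SerreGraph) : Subgroup (Equiv.Perm X.V × Equiv.Perm X.E) where
  carrier := {g | (∀ e, X.src (g.2 e) = g.1 (X.src e)) ∧ ∀ e, X.inv (g.2 e) = g.2 (X.inv e)}
  one_mem' := ⟨fun _ => rfl, fun _ => rfl⟩
  mul_mem' := fun {a b} ha hb =>
    ⟨fun e => by simp [ha.1, hb.1], fun e => by simp [ha.2, hb.2]⟩
  inv_mem' := fun {a} ha =>
    ⟨fun e => by
      have h := ha.1 (a.2.symm e)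
      rw [Equiv.apply_symm_apply] at h
      exact (a.1.symm_apply_eq.mpr h).symm,
    fun e => by
      have h := ha.2 (a.2.symm e)
      rw [Equiv.apply_symm_apply] at h
      exact (a.2.symm_apply_eq.mpr h).symm⟩

/-- The action of automorphisms on vertices. -/
instance instMulActionV (X : SerreGraph) : MulAction X.Aut X.V where
  smul g v := g.1.1 v
  one_smul _ := rfl
  mul_smul _ _ _ := rfl

/-- The action of automorphisms on oriented edges. -/
instance instMulActionE (X : SerreGraph) : MulAction X.Aut X.E where
  smul g e := g.1.2 e
  one_smul _ := rfl
  mul_smul _ _ _ := rfl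

/-- The topology of pointwise convergence on vertices and oriented edges, both discrete. This is the
compact-open topology of the automorphism group acting on the metric graph. -/
instance instTopologicalSpaceAut (X : SerreGraph) : TopologicalSpace X.Aut :=
  TopologicalSpace.induced (fun g => ((fun v => g • v : X.V → X.V), (fun e => g • e : X.E → X.E)))
    (@instTopologicalSpaceProd (X.V → X.V) (X.E → X.E)
      (@Pi.topologicalSpace X.V (fun _ => X.V) (fun _ => ⊥))
      (@Pi.topologicalSpace X.E (fun _ => X.E) (fun _ => ⊥)))

/-- `Γ` acts cocompactly: there are finitely many orbits of vertices and of edges. -/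
def ActsCocompactly {X : SerreGraph} (Γ : Subgroup X.Aut) : Prop :=
  Finite (MulAction.orbitRel.Quotient Γ X.V) ∧ Finite (MulAction.orbitRel.Quotient Γ X.E)

/-- `Γ` acts properly: for every finite set `S` of vertices only finitely many `γ ∈ Γ` satisfy
`γ S ∩ S ≠ ∅`. Vertices suffice: a compact set `K` lies in a finite subgraph, and if `γ K` meets `K`
then `γ` maps some vertex of this subgraph to a vertex of it. -/
def ActsProperly {X : SerreGraph} (Γ : Subgroup X.Aut) : Prop :=
  ∀ S : Set X.V, S.Finite → {γ : Γ | ∃ v ∈ S, γ • v ∈ S}.Finite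

/-- A uniform lattice: a discrete subgroup of the automorphism group that acts properly and
cocompactly. -/
def IsUniformLattice {X : SerreGraph} (Γ : Subgroup X.Aut) : Prop :=
  DiscreteTopology Γ ∧ ActsProperly Γ ∧ ActsCocompactly Γ

/-- A cocompact graph: the full automorphism group acts cocompactly. -/
def IsCocompact (X : SerreGraph) : Prop := ActsCocompactly (⊤ : Subgroup X.Aut)

end SerreGraph

/-! The obstruction is a failure of unimodularity. Over every node of the binary tree with a fixed
end, the graph `base` has three vertices `a`, `b`, `c`. Each `a` sends two edges to `b` and two to
`c`, and receives two per vertex from each; each `b` sends four edges to `c`, but each `c` only two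
to `b`. If a group acts properly and cocompactly preserving these letters, let `w` be the number of
orbits of a letter, weighted by inverse stabilizer orders. Counting edge orbits from both ends
(`weight_mul_eq`) gives `w a = w b`, `w a = w c` and `2 * w b = w c`, which contradicts `w a > 0`.
For the trivial group on a finite graph this is an ordinary vertex count.

Still, `base` covers finite graphs in which part of the letters is forgotten: `left` merges `b` with
`c`, and `right` merges `a` with `c`. It remains to force the surviving letter to be visible under
every covering. This is done by twisting: in `twist` each vertex is multiplied by a finite abelian
group, and hubs with one edge on one side and two on the other fix the direction of a translation at
that vertex. The twist is of order 2 at `a` and of order 3 at `b`. As these orders are coprime, a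
covering cannot send an untwisted vertex, or one with the other twist, to a vertex with the given
twist (`onV_core_mem_iff`).

Hence the letter of a vertex of `quasitree` can be read off its images under any two coverings onto
`leftQuotient` and `rightQuotient` (`jointColor_eq`). A common finite quotient would inherit the
letters and all edge counts. Automorphisms preserve the letters, since composing a covering with an
automorphism gives a covering; so a uniform lattice would preserve them too. Both are excluded by
the count. -/

namespace SerreGraph

/-! ### Coverings -/

theorem Hom.tgt_onE {X Y : SerreGraph} (f : Hom X Y) (e : X.E) :
    Y.tgt (f.onE e) = f.onV (X.tgt e) := by
  rw [tgt, f.inv_onE, f.src_onE, tgt]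

/-- Composition of morphisms. -/
def Hom.comp {X Y Z : SerreGraph} (g : Hom Y Z) (f : Hom X Y) : Hom X Z where
  onV v := g.onV (f.onV v)
  onE e := g.onE (f.onE e)
  src_onE e := by rw [g.src_onE, f.src_onE]
  inv_onE e := by rw [g.inv_onE, f.inv_onE]

theorem Hom.IsCovering.comp {X Y Z : SerreGraph} {g : Hom Y Z} {f : Hom X Y}
    (hg : g.IsCovering) (hf : f.IsCovering) : (g.comp f).IsCovering :=
  ⟨hg.1.comp hf.1, fun v => (hg.2 (f.onV v)).comp (hf.2 v)⟩

/-- The morphism underlying an automorphism. -/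
def autHom {X : SerreGraph} (g : X.Aut) : Hom X X where
  onV v := g • v
  onE e := g • e
  src_onE := g.2.1
  inv_onE := g.2.2

theorem src_smul {X : SerreGraph} (g : X.Aut) (e : X.E) : X.src (g • e) = g • X.src e :=
  g.2.1 e

theorem inv_smul {X : SerreGraph} (g : X.Aut) (e : X.E) : X.inv (g • e) = g • X.inv e :=
  g.2.2 e

theorem tgt_smul {X : SerreGraph} (g : X.Aut) (e : X.E) : X.tgt (g • e) = g • X.tgt e := by
  rw [tgt, inv_smul, src_smul, tgt]

theorem autHom_isCovering {X : SerreGraph} (g : X.Aut) : (autHom g).IsCovering := by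
  refine ⟨fun v => ⟨g⁻¹ • v, smul_inv_smul g v⟩, fun v => ⟨?_, ?_, ?_⟩⟩
  · intro e he
    exact (src_smul g e).trans (congrArg (g • ·) he)
  · intro e _ e' _ h
    exact smul_left_cancel g h
  · intro e he
    refine ⟨g⁻¹ • e, ?_, smul_inv_smul g e⟩
    change X.src (g⁻¹ • e) = v
    rw [src_smul, show X.src e = g • v from he, inv_smul_smul]

/-- A morphism with an inverse is an automorphism. -/
def autOfInverse {X : SerreGraph} (f g : Hom X X) (hV : ∀ v, g.onV (f.onV v) = v)
    (hV' : ∀ v, f.onV (g.onV v) = v) (hE : ∀ e, g.onE (f.onE e) = e)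
    (hE' : ∀ e, f.onE (g.onE e) = e) : X.Aut :=
  ⟨(⟨f.onV, g.onV, hV, hV'⟩, ⟨f.onE, g.onE, hE, hE'⟩), f.src_onE, f.inv_onE⟩

/-- The number of edges from `v` with terminal vertex of a given colour can be computed in a cover. -/
theorem ncard_star_color {X Y : SerreGraph} {f : Hom X Y} (hf : f.IsCovering) {K : Type}
    (τ : Y.V → K) (k : K) (v : X.V) :
    {e | Y.src e = f.onV v ∧ τ (Y.tgt e) = k}.ncard =
      {e | X.src e = v ∧ τ (f.onV (X.tgt e)) = k}.ncard := by
  have h := hf.2 v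
  have : {e | Y.src e = f.onV v ∧ τ (Y.tgt e) = k} =
      f.onE '' {e | X.src e = v ∧ τ (f.onV (X.tgt e)) = k} := by
    ext e
    constructor
    · rintro ⟨h1, h2⟩
      obtain ⟨e', he', rfl⟩ := h.2.2 h1
      exact ⟨e', ⟨he', by rwa [← f.tgt_onE]⟩, rfl⟩
    · rintro ⟨e', ⟨h1, h2⟩, rfl⟩
      exact ⟨h.1 h1, by rwa [f.tgt_onE]⟩
  rw [this, (h.2.1.mono fun e he => he.1).ncard_image]

/-! ### Counting edges between colour classes modulo a group -/

section Counting

variable {Z : SerreGraph} (Γ : Subgroup Z.Aut)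

open Classical in
/-- The number of orbits of vertices of colour `k`, each weighted by the inverse of the order of its
stabilizer. -/
noncomputable def weight {K : Type} (τ : Z.V → K) (k : K) : ℚ :=
  ∑ᶠ q : MulAction.orbitRel.Quotient Γ Z.V,
    if τ q.out = k then ((MulAction.stabilizer Γ q.out : Set Γ).ncard : ℚ)⁻¹ else 0

variable {Γ}

theorem ActsProperly.finite_transporter (hp : ActsProperly Γ) (u v : Z.V) :
    {γ : Γ | γ • u = v}.Finite := by
  refine (hp {u, v} (Set.toFinite _)).subset fun γ hγ => ⟨u, by simp, ?_⟩
  rw [show γ • u = v from hγ]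
  simp

theorem ActsProperly.ncard_stabilizer_pos (hp : ActsProperly Γ) (v : Z.V) :
    0 < (MulAction.stabilizer Γ v : Set Γ).ncard :=
  (Set.ncard_pos (hp.finite_transporter v v)).mpr ⟨1, one_smul _ _⟩

/-- Right multiplication by an element carrying `u` to `v` maps the stabilizer of `v` onto the
transporter. -/
theorem ncard_transporter {u v : Z.V} (h : v ∈ MulAction.orbit Γ u) :
    {γ : Γ | γ • u = v}.ncard = (MulAction.stabilizer Γ v : Set Γ).ncard := by
  obtain ⟨g, rfl⟩ := h
  symm
  refine Set.ncard_congr (fun γ _ => γ * g) ?_ ?_ ?_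
  · intro γ hγ
    change (γ * g) • u = g • u
    rw [mul_smul]
    exact hγ
  · intro γ γ' _ _ h
    exact mul_right_cancel h
  · intro γ hγ
    refine ⟨γ * g⁻¹, ?_, by simp⟩
    change (γ * g⁻¹) • (g • u) = g • u
    rw [mul_smul, inv_smul_smul]
    exact hγ

theorem weight_pos (hp : ActsProperly Γ) (hc : ActsCocompactly Γ) {K : Type} {τ : Z.V → K}
    (hτ : ∀ (γ : Γ) v, τ (γ • v) = τ v) {k : K} (hk : ∃ v, τ v = k) : 0 < weight Γ τ k := by
  classical
  obtain ⟨v, hv⟩ := hk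
  have := hc.1
  have := Fintype.ofFinite (MulAction.orbitRel.Quotient Γ Z.V)
  rw [weight, finsum_eq_sum_of_fintype]
  refine Finset.sum_pos' (fun q _ => by split_ifs <;> positivity)
    ⟨Quotient.mk'' v, Finset.mem_univ _, ?_⟩
  have h : (Quotient.mk'' v : MulAction.orbitRel.Quotient Γ Z.V).out ∈ MulAction.orbit Γ v :=
    Quotient.exact (s := MulAction.orbitRel Γ Z.V) (Quotient.out_eq' _)
  obtain ⟨γ, hγ⟩ := h
  have h2 := hp.ncard_stabilizer_pos (Quotient.mk'' v : MulAction.orbitRel.Quotient Γ Z.V).out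
  rw [if_pos (by rw [← hγ, ← hv]; exact hτ γ v)]
  positivity

/-- The pairs of an edge at `u` and a group element that moves its end to `v`. -/
def transports (Γ : Subgroup Z.Aut) (u v : Z.V) : Set (Z.E × Γ) :=
  {p | Z.src p.1 = u ∧ p.2 • Z.tgt p.1 = v}

/-- The bijection is `(e, γ) ↦ (γ • inv e, γ⁻¹)`. This symmetry is what allows edge orbits to be
counted from either end. -/
theorem ncard_transports_comm (u v : Z.V) :
    (transports Γ u v).ncard = (transports Γ v u).ncard := by
  have key : ∀ u v (p : Z.E × Γ), p ∈ transports Γ u v →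
      ((p.2 • Z.inv p.1, p.2⁻¹) : Z.E × Γ) ∈ transports Γ v u := by
    rintro u v ⟨e, γ⟩ ⟨h1, h2⟩
    dsimp only at h1 h2
    refine ⟨?_, ?_⟩
    · change Z.src ((γ : Z.Aut) • Z.inv e) = v
      rw [src_smul]
      exact h2
    · change γ⁻¹ • Z.tgt ((γ : Z.Aut) • Z.inv e) = u
      rw [tgt_smul, tgt, Z.inv_inv, h1]
      exact inv_smul_smul γ u
  have hinv : ∀ p : Z.E × Γ, ((p.2⁻¹ • Z.inv (p.2 • Z.inv p.1), p.2⁻¹⁻¹) : Z.E × Γ) = p := by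
    rintro ⟨e, γ⟩
    refine Prod.ext ?_ (_root_.inv_inv γ)
    change γ⁻¹ • Z.inv ((γ : Z.Aut) • Z.inv e) = e
    rw [inv_smul, Z.inv_inv]
    exact inv_smul_smul γ e
  refine Set.ncard_congr (fun p _ => (p.2 • Z.inv p.1, p.2⁻¹)) (fun p hp => key u v p hp) ?_ ?_
  · intro p q _ _ h
    rw [← hinv p, ← hinv q]
    exact congrArg (fun p : Z.E × Γ => ((p.2 • Z.inv p.1, p.2⁻¹) : Z.E × Γ)) h
  · intro p hp
    exact ⟨_, key v u p hp, hinv p⟩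

theorem ncard_transports (hl : Z.LocallyFinite) (hp : ActsProperly Γ) (u v : Z.V) :
    (transports Γ u v).ncard = ∑ e ∈ (hl u).toFinset, {γ : Γ | γ • Z.tgt e = v}.ncard := by
  classical
  have hfin := fun e => hp.finite_transporter (Z.tgt e) v
  have : transports Γ u v =
      (((hl u).toFinset.sigma fun e => (hfin e).toFinset).map
        (Equiv.sigmaEquivProd Z.E Γ).toEmbedding : Finset (Z.E × Γ)) := by
    ext ⟨e, γ⟩
    simp [transports, starAt]
  rw [this, Set.ncard_coe_finset, Finset.card_map, Finset.card_sigma]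
  exact Finset.sum_congr rfl fun e _ => (Set.ncard_eq_toFinset_card _ (hfin e)).symm

open Classical in
-- An edge at `u` contributes only to the orbit of its end. There it is carried to the
-- representative by as many group elements as the stabilizer has, so after division it counts once.
theorem sum_transports (hl : Z.LocallyFinite) (hp : ActsProperly Γ)
    [Fintype (MulAction.orbitRel.Quotient Γ Z.V)] {K : Type} {τ : Z.V → K}
    (hτ : ∀ (γ : Γ) v, τ (γ • v) = τ v) (t : K) (u : Z.V) :
    ∑ q : MulAction.orbitRel.Quotient Γ Z.V, (if τ q.out = t then
      ((transports Γ u q.out).ncard : ℚ) *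
        ((MulAction.stabilizer Γ q.out : Set Γ).ncard : ℚ)⁻¹ else 0) =
      ({e | Z.src e = u ∧ τ (Z.tgt e) = t}.ncard : ℚ) := by
  have h1 : ∀ q : MulAction.orbitRel.Quotient Γ Z.V, (if τ q.out = t then
      ((transports Γ u q.out).ncard : ℚ) *
        ((MulAction.stabilizer Γ q.out : Set Γ).ncard : ℚ)⁻¹ else 0) =
      ∑ e ∈ (hl u).toFinset, if q = Quotient.mk'' (Z.tgt e) then
        (if τ (Z.tgt e) = t then (1 : ℚ) else 0) else 0 := by
    intro q
    have hpos := hp.ncard_stabilizer_pos q.out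
    have hq : ∀ e, q = Quotient.mk'' (Z.tgt e) → q.out ∈ MulAction.orbit Γ (Z.tgt e) := fun e he =>
      Quotient.exact (s := MulAction.orbitRel Γ Z.V) ((Quotient.out_eq' q).trans he)
    have hc : ∀ e, q = Quotient.mk'' (Z.tgt e) → τ (Z.tgt e) = τ q.out := by
      intro e he
      obtain ⟨γ, hγ⟩ := hq e he
      rw [← hγ]
      exact (hτ γ _).symm
    by_cases hqt : τ q.out = t
    · rw [if_pos hqt, ncard_transports hl hp, Nat.cast_sum, Finset.sum_mul]
      refine Finset.sum_congr rfl fun e _ => ?_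
      by_cases he : q = Quotient.mk'' (Z.tgt e)
      · rw [if_pos he, if_pos ((hc e he).trans hqt), ncard_transporter (hq e he),
          mul_inv_cancel₀ (by positivity)]
      · have : {γ : Γ | γ • Z.tgt e = q.out} = ∅ := by
          refine Set.eq_empty_of_forall_notMem fun γ hγ => he ?_
          rw [← Quotient.out_eq' q]
          exact Quotient.sound' (s₁ := MulAction.orbitRel Γ Z.V) ⟨γ, hγ⟩
        rw [if_neg he, this]
        simp
    · rw [if_neg hqt]
      refine (Finset.sum_eq_zero fun e _ => ?_).symm
      split_ifs with he h
      · exact absurd ((hc e he).symm.trans h) hqt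
      · rfl
      · rfl
  rw [Finset.sum_congr rfl fun q _ => h1 q, Finset.sum_comm]
  simp only [Finset.sum_ite_eq', Finset.mem_univ, if_true]
  rw [Finset.sum_boole]
  congr 1
  rw [← Set.ncard_coe_finset]
  congr 1
  ext e
  simp [starAt]

/-- If all vertices of colour `s` have `a` edges to vertices of colour `t` and all vertices of colour
`t` have `b` edges to vertices of colour `s`, then the two ways of counting the orbits of such edges
agree. -/
theorem weight_mul_eq (hl : Z.LocallyFinite) (hp : ActsProperly Γ) (hc : ActsCocompactly Γ)
    {K : Type} {τ : Z.V → K} (hτ : ∀ (γ : Γ) v, τ (γ • v) = τ v) {s t : K} {a b : ℕ}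
    (ha : ∀ v, τ v = s → {e | Z.src e = v ∧ τ (Z.tgt e) = t}.ncard = a)
    (hb : ∀ v, τ v = t → {e | Z.src e = v ∧ τ (Z.tgt e) = s}.ncard = b) :
    weight Γ τ s * a = weight Γ τ t * b := by
  classical
  have := hc.1
  have := Fintype.ofFinite (MulAction.orbitRel.Quotient Γ Z.V)
  let c : MulAction.orbitRel.Quotient Γ Z.V → ℚ :=
    fun q => ((MulAction.stabilizer Γ q.out : Set Γ).ncard : ℚ)⁻¹
  -- Both sides of the claim are the same double sum over pairs of orbits, up to exchanging the
  -- roles of the two orbits.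
  have key : ∀ {s t : K} {a : ℕ},
      (∀ v, τ v = s → {e | Z.src e = v ∧ τ (Z.tgt e) = t}.ncard = a) →
      weight Γ τ s * a = ∑ q : MulAction.orbitRel.Quotient Γ Z.V,
        ∑ r : MulAction.orbitRel.Quotient Γ Z.V, if τ q.out = s ∧ τ r.out = t then
          (transports Γ q.out r.out).ncard * c q * c r else 0 := by
    intro s t a ha
    rw [weight, finsum_eq_sum_of_fintype, Finset.sum_mul]
    refine Finset.sum_congr rfl fun q _ => ?_
    by_cases hq : τ q.out = s
    · rw [if_pos hq, ← ha _ hq, ← sum_transports hl hp hτ, Finset.mul_sum]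
      refine Finset.sum_congr rfl fun r _ => ?_
      by_cases hr : τ r.out = t
      · rw [if_pos hr, if_pos ⟨hq, hr⟩]
        simp only [c]
        ring
      · rw [if_neg hr, if_neg fun h => hr h.2, mul_zero]
    · simp [hq]
  rw [key ha, key hb, Finset.sum_comm]
  refine Finset.sum_congr rfl fun r _ => Finset.sum_congr rfl fun q _ => ?_
  rw [ncard_transports_comm]
  by_cases h : τ q.out = s ∧ τ r.out = t
  · rw [if_pos h, if_pos h.symm]
    ring
  · rw [if_neg h, if_neg fun h' => h h'.symm]

end Counting

/-! ### Twisted products -/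

/-- Vertices of a twisted product. -/
inductive TwistVertex (V F : Type) : Type
  | core (v : V) (f : F)
  | hub (v : V) (f : F)

/-- Oriented edges of a twisted product. -/
inductive TwistEdge (V E F : Type) : Type
  | link (e : E) (f : F)
  | spoke (v : V) (f : F) (s : Fin 3) (b : Bool)

open TwistVertex TwistEdge

section Twist

variable {F F' : Type} [AddCommGroup F] [AddCommGroup F']

/-- The translation along a spoke. -/
def spokeShift (a : F) (s : Fin 3) : F := if s = 0 then 0 else a

/-- The product of `Y` with the set `F`, in which every vertex `(v, f)` is joined to `(v, f + α v)`
through a hub: the hub has one edge to the former and two edges to the latter. -/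
abbrev twist (Y : SerreGraph) (α : Y.V → F) : SerreGraph where
  V := TwistVertex Y.V F
  E := TwistEdge Y.V Y.E F
  src
    | link e f => core (Y.src e) f
    | spoke v f s true => core v (f + spokeShift (α v) s)
    | spoke v f _ false => hub v f
  inv
    | link e f => link (Y.inv e) f
    | spoke v f s b => spoke v f s (!b)
  inv_inv
    | link e f => by simp [Y.inv_inv]
    | spoke v f s b => by simp
  inv_ne
    | link e f => by simp [Y.inv_ne]
    | spoke v f s b => by simp

variable {Y Y' : SerreGraph} {α : Y.V → F} {α' : Y'.V → F'}

theorem twist_tgt_link (e : Y.E) (f : F) :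
    (twist Y α).tgt (link e f) = core (Y.tgt e) f := rfl

theorem twist_tgt_spoke (v : Y.V) (f : F) (s : Fin 3) :
    (twist Y α).tgt (spoke v f s false) = core v (f + spokeShift (α v) s) := rfl

theorem twist_src_eq_core {e : (twist Y α).E} {v : Y.V} {f : F}
    (h : (twist Y α).src e = core v f) :
    (∃ e', Y.src e' = v ∧ e = link e' f) ∨
      ∃ s, e = spoke v (f - spokeShift (α v) s) s true := by
  rcases e with ⟨e, f'⟩ | ⟨w, f', s, _ | _⟩
  · obtain ⟨rfl, rfl⟩ := TwistVertex.core.inj h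
    exact .inl ⟨e, rfl, rfl⟩
  · cases h
  · obtain ⟨rfl, rfl⟩ := TwistVertex.core.inj h
    exact .inr ⟨s, by rw [add_sub_cancel_right]⟩

theorem twist_src_eq_hub {e : (twist Y α).E} {v : Y.V} {f : F}
    (h : (twist Y α).src e = hub v f) : ∃ s, e = spoke v f s false := by
  rcases e with ⟨e, f'⟩ | ⟨w, f', s, _ | _⟩
  · cases h
  · obtain ⟨rfl, rfl⟩ := TwistVertex.hub.inj h
    exact ⟨s, rfl⟩
  · cases h

/-- The morphism of twisted products induced by a morphism and a homomorphism. -/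
def twistMap (h : Hom Y Y') (φ : F →+ F') (hα : ∀ v, α' (h.onV v) = φ (α v)) :
    Hom (twist Y α) (twist Y' α') where
  onV
    | core v f => core (h.onV v) (φ f)
    | hub v f => hub (h.onV v) (φ f)
  onE
    | link e f => link (h.onE e) (φ f)
    | spoke v f s b => spoke (h.onV v) (φ f) s b
  src_onE
    | link e f => congrArg (core · (φ f)) (h.src_onE e)
    | spoke v f s true => by
      have : φ (spokeShift (α v) s) = spokeShift (φ (α v)) s := by
        unfold spokeShift
        split_ifs
        · exact map_zero φ
        · rfl
      simp only [twist, map_add, this, hα]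
    | spoke v f _ false => rfl
  inv_onE
    | link e f => congrArg (link · (φ f)) (h.inv_onE e)
    | spoke v f s b => rfl

theorem twistMap_isCovering {h : Hom Y Y'} (hh : h.IsCovering) {φ : F →+ F'}
    (hφ : Function.Surjective φ) (hα : ∀ v, α' (h.onV v) = φ (α v)) :
    (twistMap h φ hα).IsCovering := by
  refine ⟨?_, fun x => ⟨?_, ?_, ?_⟩⟩
  · rintro (⟨v, f⟩ | ⟨v, f⟩)
    · obtain ⟨v, rfl⟩ := hh.1 v
      obtain ⟨f, rfl⟩ := hφ f
      exact ⟨core v f, rfl⟩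
    · obtain ⟨v, rfl⟩ := hh.1 v
      obtain ⟨f, rfl⟩ := hφ f
      exact ⟨hub v f, rfl⟩
  · intro e he
    exact ((twistMap h φ hα).src_onE e).trans (congrArg _ he)
  · intro e he e' he' hee'
    rcases x with ⟨v, f⟩ | ⟨v, f⟩
    · rcases twist_src_eq_core he with ⟨e, h1, rfl⟩ | ⟨s, rfl⟩ <;>
        rcases twist_src_eq_core he' with ⟨e', h2, rfl⟩ | ⟨s', rfl⟩
      · rw [(hh.2 v).2.1 h1 h2 (TwistEdge.link.inj hee').1]
      · cases hee'
      · cases hee'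
      · obtain rfl := (TwistEdge.spoke.inj hee').2.2.1
        rfl
    · obtain ⟨s, rfl⟩ := twist_src_eq_hub he
      obtain ⟨s', rfl⟩ := twist_src_eq_hub he'
      obtain rfl := (TwistEdge.spoke.inj hee').2.2.1
      rfl
  · intro e he
    rcases x with ⟨v, f⟩ | ⟨v, f⟩
    · rcases twist_src_eq_core he with ⟨e, h1, rfl⟩ | ⟨s, rfl⟩
      · obtain ⟨e, h2, rfl⟩ := (hh.2 v).2.2 h1
        exact ⟨link e f, congrArg (core · f) h2, rfl⟩
      · refine ⟨spoke v (f - spokeShift (α v) s) s true, congrArg (core v) (by simp), ?_⟩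
        refine congrArg (spoke (h.onV v) · s true) ?_
        rw [map_sub, hα]
        unfold spokeShift
        split_ifs
        · rw [map_zero]
        · rfl
    · obtain ⟨s, rfl⟩ := twist_src_eq_hub he
      exact ⟨spoke v f s false, rfl, rfl⟩

theorem twist_isFinite (hY : Y.IsFinite) [Finite F] : (twist Y α).IsFinite := by
  have := hY.1
  have := hY.2
  constructor
  · refine Finite.of_surjective
      (fun p : Bool × Y.V × F => if p.1 then core p.2.1 p.2.2 else hub p.2.1 p.2.2) ?_
    rintro (⟨v, f⟩ | ⟨v, f⟩)
    · exact ⟨(true, v, f), rfl⟩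
    · exact ⟨(false, v, f), rfl⟩
  · refine Finite.of_surjective (fun p : (Y.E × F) ⊕ (Y.V × F × Fin 3 × Bool) =>
      Sum.elim (fun p => link p.1 p.2) (fun p => spoke p.1 p.2.1 p.2.2.1 p.2.2.2) p) ?_
    rintro (⟨e, f⟩ | ⟨v, f, s, b⟩)
    · exact ⟨.inl (e, f), rfl⟩
    · exact ⟨.inr (v, f, s, b), rfl⟩

theorem twist_locallyFinite (hY : Y.LocallyFinite) : (twist Y α).LocallyFinite := by
  rintro (⟨v, f⟩ | ⟨v, f⟩)
  · refine (((hY v).image (link · f)).union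
      (Set.finite_range fun s => spoke v (f - spokeShift (α v) s) s true)).subset fun e he => ?_
    rcases twist_src_eq_core he with ⟨e, h1, rfl⟩ | ⟨s, rfl⟩
    · exact .inl ⟨e, h1, rfl⟩
    · exact .inr ⟨s, rfl⟩
  · refine (Set.finite_range fun s => spoke v f s false).subset fun e he => ?_
    obtain ⟨s, rfl⟩ := twist_src_eq_hub he
    exact ⟨s, rfl⟩

/-! ### Rigidity of coverings between twisted products -/

theorem ncard_star_hub (v : Y.V) (f : F) : ((twist Y α).starAt (hub v f)).ncard = 3 := by
  have : (twist Y α).starAt (hub v f) = Set.range fun s => spoke v f s false := by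
    ext e
    constructor
    · intro he
      obtain ⟨s, rfl⟩ := twist_src_eq_hub he
      exact ⟨s, rfl⟩
    · rintro ⟨s, rfl⟩
      rfl
  rw [this, ← Set.image_univ, Set.InjOn.ncard_image]
  · simp
  · intro s _ s' _ h
    exact (TwistEdge.spoke.inj h).2.2.1

theorem three_lt_ncard_star_core (hl : Y.LocallyFinite) (hY : ∀ v, ∃ e, Y.src e = v) (v : Y.V)
    (f : F) : 3 < ((twist Y α).starAt (core v f)).ncard := by
  obtain ⟨e, he⟩ := hY v
  let g : Option (Fin 3) → (twist Y α).E := fun o =>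
    o.elim (link e f) fun s => spoke v (f - spokeShift (α v) s) s true
  have hg : Function.Injective g := by
    rintro (_ | s) (_ | s') h
    · rfl
    · cases h
    · cases h
    · rw [(TwistEdge.spoke.inj h).2.2.1]
  have hsub : Set.range g ⊆ (twist Y α).starAt (core v f) := by
    rintro _ ⟨_ | s, rfl⟩
    · exact congrArg (core · f) he
    · exact congrArg (core v) (by simp)
  calc 3 < (Set.range g).ncard := by
        rw [← Set.image_univ, Set.ncard_image_of_injective _ hg]
        simp
    _ ≤ _ := Set.ncard_le_ncard hsub (twist_locallyFinite hl _)

theorem ncard_star_eq {X Z : SerreGraph} {f : Hom X Z} (hf : f.IsCovering) (v : X.V) :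
    (Z.starAt (f.onV v)).ncard = (X.starAt v).ncard := by
  rw [← (hf.2 v).image_eq, (hf.2 v).injOn.ncard_image]

section Covering

variable {ψ : Hom (twist Y α) (twist Y' α')}

/-- Coverings preserve valence, which is 3 at hubs and larger at core vertices. -/
theorem exists_core (hψ : ψ.IsCovering) (hl : Y.LocallyFinite) (hY : ∀ v, ∃ e, Y.src e = v)
    (v : Y.V) (f : F) : ∃ u i, ψ.onV (core v f) = core u i := by
  have h1 := three_lt_ncard_star_core (α := α) hl hY v f
  have h2 := ncard_star_eq hψ (core v f)
  rcases h : ψ.onV (core v f) with ⟨u, i⟩ | ⟨u, i⟩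
  · exact ⟨u, i, rfl⟩
  · rw [h, ncard_star_hub] at h2
    omega

theorem exists_hub (hψ : ψ.IsCovering) (hl : Y'.LocallyFinite) (hY : ∀ v, ∃ e, Y'.src e = v)
    (v : Y.V) (f : F) : ∃ u i, ψ.onV (hub v f) = hub u i := by
  have h2 := ncard_star_eq hψ (hub v f)
  rcases h : ψ.onV (hub v f) with ⟨u, i⟩ | ⟨u, i⟩
  · have h1 := three_lt_ncard_star_core (α := α') hl hY u i
    rw [h, ncard_star_hub] at h2
    omega
  · exact ⟨u, i, rfl⟩

/-- A covering permutes the three spokes of a hub. If the two sides of the image hub are distinct,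
the pair of spokes with a common end must go to the pair with a common end, so the direction of
translation is preserved. -/
theorem onV_core_add (hψ : ψ.IsCovering) (hl : Y'.LocallyFinite)
    (hY : ∀ v, ∃ e, Y'.src e = v) {v : Y.V} {f : F} {u : Y'.V} {i : F'}
    (h : ψ.onV (core v f) = core u i) (hu : α' u ≠ 0) :
    ψ.onV (core v (f + α v)) = core u (i + α' u) := by
  obtain ⟨w, j, hw⟩ := exists_hub hψ hl hY v f
  have hs : ∀ s, ∃ r, ψ.onE (spoke v f s false) = spoke w j r false := by
    intro s
    apply twist_src_eq_hub
    rw [ψ.src_onE, ← hw]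
  choose σ hσ using hs
  have hinj : Function.Injective σ := by
    intro s s' hss
    have := (hψ.2 (hub v f)).2.1
      (show spoke v f s false ∈ (twist Y α).starAt (hub v f) from rfl)
      (show spoke v f s' false ∈ (twist Y α).starAt (hub v f) from rfl) (by rw [hσ, hσ, hss])
    exact (TwistEdge.spoke.inj this).2.2.1
  have ht : ∀ s, ψ.onV (core v (f + spokeShift (α v) s)) =
      core w (j + spokeShift (α' w) (σ s)) := by
    intro s
    rw [← twist_tgt_spoke, ← ψ.tgt_onE, hσ, twist_tgt_spoke]
  have h0 := ht 0
  simp only [spokeShift, if_true, add_zero] at h0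
  rw [h] at h0
  obtain ⟨rfl, h0⟩ := TwistVertex.core.inj h0
  have h1 := ht 1
  have h2 := ht 2
  have h12 : spokeShift (α' u) (σ 1) = spokeShift (α' u) (σ 2) := by
    have := h1.symm.trans h2
    exact add_left_cancel (TwistVertex.core.inj this).2
  have hσ1 : σ 1 ≠ 0 := by
    intro hz
    have hz2 : σ 2 ≠ 0 := fun h => absurd (hinj (hz.trans h.symm)) (by decide)
    simp only [spokeShift, hz, hz2, if_true, if_false] at h12
    exact hu h12.symm
  have hσ2 : σ 2 ≠ 0 := by
    intro hz
    simp only [spokeShift, hz, hσ1, if_true, if_false] at h12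
    exact hu h12
  have hσ0 : σ 0 = 0 := by
    have := hinj.ne (show (1 : Fin 3) ≠ 2 by decide)
    have := hinj.ne (show (0 : Fin 3) ≠ 1 by decide)
    have := hinj.ne (show (0 : Fin 3) ≠ 2 by decide)
    omega
  simp only [hσ0, if_true, add_zero] at h0
  simp only [spokeShift, hσ1, if_false, one_ne_zero] at h1
  rw [h1, h0]

theorem onV_core_add_nsmul (hψ : ψ.IsCovering) (hl : Y'.LocallyFinite)
    (hY : ∀ v, ∃ e, Y'.src e = v) {v : Y.V} {f : F} {u : Y'.V} {i : F'}
    (h : ψ.onV (core v f) = core u i) (hu : α' u ≠ 0) (n : ℕ) :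
    ψ.onV (core v (f + n • α v)) = core u (i + n • α' u) := by
  induction n with
  | zero => simpa using h
  | succ n ih =>
    rw [succ_nsmul, succ_nsmul, ← add_assoc, ← add_assoc]
    exact onV_core_add hψ hl hY ih hu

/-- A covering of twisted products reflects and preserves the sets of vertices `S` and `S'`, where
`S'` consists of vertices whose twist has order not dividing `n`, all vertices outside `S` have a
twist of order dividing `n`, each vertex outside `S'` has a neighbour in `S'`, and each vertex in `S`
is the only neighbour in `S` of some vertex outside `S`. -/
theorem onV_core_mem_iff (hψ : ψ.IsCovering) (hl : Y.LocallyFinite)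
    (hY : ∀ v, ∃ e, Y.src e = v) (hl' : Y'.LocallyFinite) (hY' : ∀ v, ∃ e, Y'.src e = v)
    {S : Set Y.V} {S' : Set Y'.V} (n : ℕ) (hS : ∀ v ∉ S, n • α v = 0)
    (hS' : ∀ u ∈ S', n • α' u ≠ 0) (hnbr' : ∀ u ∉ S', ∃ e, Y'.src e = u ∧ Y'.tgt e ∈ S')
    (hnbr : ∀ v ∈ S, ∃ w ∉ S, ∀ e, Y.src e = w → Y.tgt e ∈ S → Y.tgt e = v)
    {v : Y.V} {f : F} {u : Y'.V} {i : F'} (h : ψ.onV (core v f) = core u i) :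
    u ∈ S' ↔ v ∈ S := by
  have key : ∀ {v : Y.V} {f : F} {u : Y'.V} {i : F'}, ψ.onV (core v f) = core u i →
      u ∈ S' → v ∈ S := by
    intro v f u i h hu
    by_contra hv
    have hne : α' u ≠ 0 := fun h0 => hS' u hu (by rw [h0, smul_zero])
    -- After `n` translations the source vertex has returned, so its image must have returned as
    -- well, against `hS'`.
    have := onV_core_add_nsmul hψ hl' hY' h hne n
    rw [hS v hv, add_zero, h] at this
    exact hS' u hu (left_eq_add.mp (TwistVertex.core.inj this).2)
  refine ⟨key h, fun hv => ?_⟩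
  obtain ⟨w, hw, huniq⟩ := hnbr v hv
  obtain ⟨x, j, hx⟩ := exists_core hψ hl hY w f
  -- The image `x` of `w` lies outside `S'`, so it has a neighbour in `S'`. The lift at `w` of the
  -- edge to it ends in `S` by `key`, hence at `v`.
  obtain ⟨e', he', ht'⟩ := hnbr' x fun hxS => hw (key hx hxS)
  obtain ⟨e, he, hee⟩ := (hψ.2 (core w f)).2.2
    (show link e' j ∈ (twist Y' α').starAt (ψ.onV (core w f)) from
      show core (Y'.src e') j = _ by rw [he', hx])
  have ht := ψ.tgt_onE e
  rw [hee, twist_tgt_link] at ht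
  rcases twist_src_eq_core he with ⟨e, h1, rfl⟩ | ⟨s, rfl⟩
  · rw [twist_tgt_link] at ht
    have := huniq e h1 (key ht.symm ht')
    rw [this, h] at ht
    rwa [(TwistVertex.core.inj ht).1] at ht'
  · obtain ⟨_, _, hc⟩ := exists_hub hψ hl' hY' w (f - spokeShift (α w) s)
    rw [show (twist Y α).tgt (spoke w (f - spokeShift (α w) s) s true) =
      hub w (f - spokeShift (α w) s) from rfl, hc] at ht
    cases ht

end Covering

end Twist

/-! ### Graphs given by an involution of ports -/

section OfPorts

variable {V P V' P' : Type} {ι : V × P → V × P} {ι' : V' × P' → V' × P'}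

/-- The graph in which every vertex `v` has two oriented edges for each port `p`, which lead to the
vertex of the port `ι (v, p)`. The fixed points of `ι` give loops, all other ports give double
edges. -/
abbrev ofPorts (ι : V × P → V × P) (hι : Function.Involutive ι) : SerreGraph where
  V := V
  E := (V × P) × Bool
  src e := e.1.1
  inv e := (ι e.1, !e.2)
  inv_inv e := by simp [hι e.1]
  inv_ne e := by simp [Prod.ext_iff]

variable {hι : Function.Involutive ι} {hι' : Function.Involutive ι'}

theorem ofPorts_tgt (x : V × P) (j : Bool) : (ofPorts ι hι).tgt (x, j) = (ι x).1 := rfl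

theorem ofPorts_exists_src [Nonempty P] (v : V) : ∃ e, (ofPorts ι hι).src e = v :=
  ⟨((v, Classical.arbitrary P), true), rfl⟩

theorem ofPorts_isFinite [Finite V] [Finite P] : (ofPorts ι hι).IsFinite :=
  ⟨inferInstanceAs (Finite V), inferInstanceAs (Finite ((V × P) × Bool))⟩

theorem ofPorts_locallyFinite [Finite P] : (ofPorts ι hι).LocallyFinite := by
  intro v
  refine (Set.finite_range fun p : P × Bool => ((v, p.1), p.2)).subset ?_
  rintro ⟨⟨w, p⟩, j⟩ h
  obtain rfl : w = v := h
  exact ⟨(p, j), rfl⟩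

/-- The morphism induced by maps of vertices and of ports. -/
def ofPortsMap (f : V → V') (π : V → P → P')
    (h : ∀ v p, ι' (f v, π v p) = (f (ι (v, p)).1, π (ι (v, p)).1 (ι (v, p)).2)) :
    Hom (ofPorts ι hι) (ofPorts ι' hι') where
  onV := f
  onE e := ((f e.1.1, π e.1.1 e.1.2), e.2)
  src_onE _ := rfl
  inv_onE e := Prod.ext (h e.1.1 e.1.2) rfl

/-- A port moved by `ι` may go to a port fixed by `ι'`: the double edge then wraps around a loop.
Edges are doubled to make this possible. -/
theorem ofPortsMap_isCovering {f : V → V'} {π : V → P → P'}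
    (h : ∀ v p, ι' (f v, π v p) = (f (ι (v, p)).1, π (ι (v, p)).1 (ι (v, p)).2))
    (hf : Function.Surjective f) (hπ : ∀ v, Function.Bijective (π v)) :
    (ofPortsMap (hι := hι) (hι' := hι') f π h).IsCovering := by
  refine ⟨hf, fun v => ⟨?_, ?_, ?_⟩⟩
  · rintro ⟨⟨w, p⟩, j⟩ hw
    exact congrArg f hw
  · rintro ⟨⟨w, p⟩, j⟩ hw ⟨⟨w', p'⟩, j'⟩ hw' heq
    obtain rfl : w = v := hw
    obtain rfl : w' = w := hw'
    obtain ⟨h1, h2⟩ := Prod.ext_iff.mp heq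
    exact Prod.ext (Prod.ext rfl ((hπ w').1 (Prod.ext_iff.mp h1).2)) h2
  · rintro ⟨⟨w, p⟩, j⟩ hw
    obtain rfl : w = f v := hw
    obtain ⟨p, rfl⟩ := (hπ v).2 p
    exact ⟨((v, p), j), rfl, rfl⟩

end OfPorts

/-! ### The binary tree with a fixed end -/

/-- The vertices of the binary tree with a fixed end: a level, and the finitely many nonzero binary
digits that describe the way from the end. -/
abbrev Node : Type := ℤ × ℕ

namespace Node

/-- The neighbour in the direction of the fixed end. -/
def parent (ν : Node) : Node := (ν.1 - 1, ν.2.div2)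

/-- The two other neighbours. -/
def child (x : Bool) (ν : Node) : Node := (ν.1 + 1, Nat.bit x ν.2)

/-- The last digit. -/
def digit (ν : Node) : Bool := ν.2.bodd

@[simp] theorem parent_child (x : Bool) (ν : Node) : parent (child x ν) = ν := by
  simp [parent, child, Nat.div2_bit]

@[simp] theorem digit_child (x : Bool) (ν : Node) : digit (child x ν) = x := by
  simp [digit, child]

@[simp] theorem child_digit_parent (ν : Node) : child (digit ν) (parent ν) = ν := by
  simp [parent, child, digit, Nat.bit_bodd_div2]

/-- The sum of the binary digits modulo three. -/
def digitSum (k : ℕ) : ZMod 3 := (k.bits.count true : ℕ)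

theorem digitSum_bit (x : Bool) (k : ℕ) :
    digitSum (Nat.bit x k) = digitSum k + if x then 1 else 0 := by
  by_cases h : k = 0 ∧ x = false
  · obtain ⟨rfl, rfl⟩ := h
    simp [digitSum]
  · have : k = 0 → x = true := by simpa using h
    rw [digitSum, digitSum, Nat.bits_append_bit _ _ this]
    cases x <;> simp

/-- A colour in `ℤ/3` such that the colours of a node and of its children are distinct. -/
def color (ν : Node) : ZMod 3 := ν.1 + digitSum ν.2

theorem color_child (x : Bool) (ν : Node) : color (child x ν) = color ν + (if x then 2 else 1) := by
  simp only [color, child, digitSum_bit, Int.cast_add, Int.cast_one]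
  have : (2 : ZMod 3) = 1 + 1 := by decide
  cases x
  · simp
    ring
  · simp [this]
    ring

/-- The parity of the level. -/
def parity (ν : Node) : Bool := ν.1.bodd

theorem parity_child (x : Bool) (ν : Node) : parity (child x ν) = !parity ν := by
  simp [parity, child, Int.bodd_add]

end Node

open Node

/-! ### The three untwisted graphs -/

/-- The three kinds of vertices of the base graph. -/
inductive Letter : Type
  | a | b | c
  deriving DecidableEq

instance : Finite Letter := by
  refine Finite.of_surjective (fun i : Fin 3 => if i = 0 then Letter.a else
    if i = 1 then Letter.b else Letter.c) ?_
  rintro (_ | _ | _)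
  exacts [⟨0, rfl⟩, ⟨1, rfl⟩, ⟨2, rfl⟩]

open Letter

/-- The ports of the base graph: over each node `ν` there are vertices `a`, `b` and `c`; the vertex
`a` is joined to `b` and `c`, and `b` is joined to the vertices `c` over the children of `ν`. -/
def basePort : (Node × Letter) × Option Bool → (Node × Letter) × Option Bool
  | ((ν, a), none) => ((ν, a), none)
  | ((ν, a), some false) => ((ν, b), none)
  | ((ν, a), some true) => ((ν, c), none)
  | ((ν, b), none) => ((ν, a), some false)
  | ((ν, b), some x) => ((child x ν, c), some x)
  | ((ν, c), none) => ((ν, a), some true)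
  | ((ν, c), some x) => if x = digit ν then ((parent ν, b), some x) else ((ν, c), some x)

theorem basePort_involutive : Function.Involutive basePort := by
  rintro ⟨⟨ν, _ | _ | _⟩, _ | _ | _⟩
  all_goals simp only [basePort, digit_child, if_true, parent_child]
  all_goals
    split_ifs with h
    · simp only [h, child_digit_parent]
    · simp only [h, if_false]

/-- The base graph. -/
abbrev base : SerreGraph := ofPorts basePort basePort_involutive

/-- The ports of a finite quotient of the base graph in which only the vertices `a`, here `none`, can
be recognized. -/
def leftPort : Option Bool × Option Bool → Option Bool × Option Bool
  | (none, none) => (none, none)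
  | (none, some i) => (some i, none)
  | (some i, none) => (none, some i)
  | (some i, some x) => (some i, some x)

theorem leftPort_involutive : Function.Involutive leftPort := by
  rintro ⟨_ | _, _ | _⟩ <;> rfl

/-- A finite quotient of the base graph in which only the vertices `a` can be recognized. -/
abbrev left : SerreGraph := ofPorts leftPort leftPort_involutive

/-- The ports of a finite quotient of the base graph in which only the vertices `b`, here `none`, can
be recognized. -/
def rightPort : Option (ZMod 3) × ZMod 3 → Option (ZMod 3) × ZMod 3
  | (none, i) => (some i, 0)
  | (some i, r) => if r = 0 then (none, i) else (some i, r)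

theorem rightPort_involutive : Function.Involutive rightPort := by
  rintro ⟨_ | i, r⟩
  · simp [rightPort]
  · by_cases h : r = 0 <;> simp [rightPort, h]

/-- A finite quotient of the base graph in which only the vertices `b` can be recognized. -/
abbrev right : SerreGraph := ofPorts rightPort rightPort_involutive

/-- The covering of `left` on vertices. -/
def leftVertex : Node × Letter → Option Bool
  | (_, a) => none
  | (ν, b) => some (parity ν)
  | (ν, c) => some !(parity ν)

/-- The covering of `left` on ports. -/
def leftMap : Node × Letter → Option Bool → Option Bool
  | (ν, a), some x => some (xor x (parity ν))
  | _, p => p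

/-- The parity is reversed at `c` so that `b` over a node and `c` over its children have the same
image, where the edges between them become loops, while the two neighbours `b` and `c` of each `a`
stay distinct. -/
theorem leftPort_map (v : Node × Letter) (p : Option Bool) :
    leftPort (leftVertex v, leftMap v p) =
      (leftVertex (basePort (v, p)).1, leftMap (basePort (v, p)).1 (basePort (v, p)).2) := by
  rcases v with ⟨ν, _ | _ | _⟩ <;> rcases p with _ | x
  · rfl
  · cases x <;> simp [leftPort, leftVertex, leftMap, basePort]
  · simp [leftPort, leftVertex, leftMap, basePort]
  · simp [leftPort, leftVertex, leftMap, basePort, parity_child]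
  · simp [leftPort, leftVertex, leftMap, basePort]
  · by_cases h : x = digit ν
    · have := parity_child (digit ν) (parent ν)
      rw [child_digit_parent] at this
      simp [leftPort, leftVertex, leftMap, basePort, h, this]
    · simp [leftPort, leftVertex, leftMap, basePort, h]

/-- The covering of `left` by the base graph. -/
def baseToLeft : Hom base left := ofPortsMap leftVertex leftMap leftPort_map

theorem baseToLeft_isCovering : baseToLeft.IsCovering := by
  refine ofPortsMap_isCovering leftPort_map ?_ ?_
  · rintro (_ | i)
    · exact ⟨((0, 0), a), rfl⟩
    · cases i
      · exact ⟨((0, 0), b), rfl⟩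
      · exact ⟨((0, 0), c), rfl⟩
  · rintro ⟨ν, _ | _ | _⟩
    · refine Function.Involutive.bijective ?_
      rintro (_ | x) <;> simp [leftMap]
    · exact Function.bijective_id
    · exact Function.bijective_id

/-- The covering of `right` on vertices. -/
def rightVertex : Node × Letter → Option (ZMod 3)
  | (_, b) => none
  | (ν, _) => some (color ν)

/-- The covering of `right` on ports. -/
def rightMap : Node × Letter → Option Bool → ZMod 3
  | (_, a), none => 2
  | (_, a), some false => 0
  | (_, a), some true => 1
  | (ν, b), none => color ν
  | (ν, b), some x => color ν + (if x then 2 else 1)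
  | (_, c), none => 1
  | (ν, c), some x => if x = digit ν then 0 else 2

/-- Here `a` and `c` over a node are identified and the edges between them become loops. The vertex
`b` needs three neighbours with distinct images, namely `a` over its node and `c` over the two
children; this is the property of `color`. -/
theorem rightPort_map (v : Node × Letter) (p : Option Bool) :
    rightPort (rightVertex v, rightMap v p) =
      (rightVertex (basePort (v, p)).1, rightMap (basePort (v, p)).1 (basePort (v, p)).2) := by
  have h1 : (1 : ZMod 3) ≠ 0 := by decide
  have h2 : (2 : ZMod 3) ≠ 0 := by decide
  rcases v with ⟨ν, _ | _ | _⟩ <;> rcases p with _ | x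
  · simp [rightPort, rightVertex, rightMap, basePort, h2]
  · cases x <;> simp [rightPort, rightVertex, rightMap, basePort]
  · simp [rightPort, rightVertex, rightMap, basePort]
  · simp [rightPort, rightVertex, rightMap, basePort, color_child]
  · simp [rightPort, rightVertex, rightMap, basePort]
  · by_cases h : x = digit ν
    · have := color_child (digit ν) (parent ν)
      rw [child_digit_parent] at this
      simp [rightPort, rightVertex, rightMap, basePort, h, this]
    · simp [rightPort, rightVertex, rightMap, basePort, h, h2]

/-- The covering of `right` by the base graph. -/
def baseToRight : Hom base right := ofPortsMap rightVertex rightMap rightPort_map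

theorem baseToRight_isCovering : baseToRight.IsCovering := by
  refine ofPortsMap_isCovering rightPort_map ?_ ?_
  · rintro (_ | i)
    · exact ⟨((0, 0), b), rfl⟩
    · refine ⟨((i.val, 0), a), ?_⟩
      simp [rightVertex, color, digitSum]
  · have hcard : Fintype.card (Option Bool) = Fintype.card (ZMod 3) := rfl
    intro v
    rw [Fintype.bijective_iff_injective_and_card]
    refine ⟨?_, hcard⟩
    rcases v with ⟨ν, _ | _ | _⟩
    · rintro (_ | _ | _) (_ | _ | _) h
      all_goals first | rfl | exact absurd h (by simp only [rightMap]; decide)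
    · have key : ∀ (i : ZMod 3) (p q : Option Bool),
          p.elim i (fun x => i + if x then 2 else 1) = q.elim i (fun x => i + if x then 2 else 1) →
            p = q := by decide
      intro p q h
      refine key (color ν) p q ?_
      cases p <;> cases q <;> exact h
    · have key : ∀ (y : Bool) (p q : Option Bool), p.elim (1 : ZMod 3)
          (fun x => if x = y then 0 else 2) = q.elim 1 (fun x => if x = y then 0 else 2) →
            p = q := by decide
      intro p q h
      refine key (digit ν) p q ?_
      cases p <;> cases q <;> exact h

/-! ### Automorphisms of the base graph -/

namespace Node

/-- Adding the digits `g` to a node. -/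
def addDigits (g : ℤ → ℕ) (ν : Node) : Node := (ν.1, ν.2 ^^^ g ν.1)

variable {g : ℤ → ℕ} (hg : ∀ n, g n = (g (n + 1)).div2)

include hg in
theorem addDigits_child (x : Bool) (ν : Node) :
    addDigits g (child x ν) = child (xor x (g (ν.1 + 1)).bodd) (addDigits g ν) := by
  refine Prod.ext rfl ?_
  change Nat.bit x ν.2 ^^^ g (ν.1 + 1) = Nat.bit (xor x (g (ν.1 + 1)).bodd) (ν.2 ^^^ g ν.1)
  conv_lhs => rw [← Nat.bit_bodd_div2 (g (ν.1 + 1)), Nat.xor_bit, ← hg]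

include hg in
theorem addDigits_eq_child (ν : Node) : addDigits g ν =
    child (xor (digit ν) (g ν.1).bodd) (addDigits g (parent ν)) := by
  have := addDigits_child hg (digit ν) (parent ν)
  rwa [child_digit_parent, show (parent ν).1 + 1 = ν.1 from sub_add_cancel _ _] at this

include hg in
theorem digit_addDigits (ν : Node) : digit (addDigits g ν) = xor (digit ν) (g ν.1).bodd := by
  rw [addDigits_eq_child hg, digit_child]

include hg in
theorem parent_addDigits (ν : Node) : parent (addDigits g ν) = addDigits g (parent ν) := by
  rw [addDigits_eq_child hg, parent_child]

theorem addDigits_addDigits (g : ℤ → ℕ) (ν : Node) : addDigits g (addDigits g ν) = ν := by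
  simp [addDigits]

/-- Every number is the sequence of digits up to some level of a compatible sequence. -/
theorem exists_digits (n : ℤ) (k : ℕ) : ∃ g : ℤ → ℕ, (∀ n, g n = (g (n + 1)).div2) ∧ g n = k := by
  -- Above level `n` zeros are appended, below it digits are dropped; by truncation one of the two
  -- exponents is always zero.
  refine ⟨fun m => k * 2 ^ (m - n).toNat / 2 ^ (n - m).toNat, fun m => ?_, by simp⟩
  dsimp only
  rw [Nat.div2_val]
  rcases le_or_gt n m with h | h
  · rw [show (m + 1 - n).toNat = (m - n).toNat + 1 by omega,
      show (n - m).toNat = 0 by omega, show (n - (m + 1)).toNat = 0 by omega, pow_succ,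
      ← mul_assoc]
    simp
  · rw [show (m + 1 - n).toNat = 0 by omega, show (m - n).toNat = 0 by omega,
      show (n - m).toNat = (n - (m + 1)).toNat + 1 by omega, pow_succ, Nat.div_div_eq_div_mul]

/-- Moving a node by `m` levels. -/
def shift (m : ℤ) (ν : Node) : Node := (ν.1 + m, ν.2)

theorem shift_child (m : ℤ) (x : Bool) (ν : Node) :
    shift m (child x ν) = child x (shift m ν) := by
  simp [shift, child, add_right_comm]

theorem shift_parent (m : ℤ) (ν : Node) : shift m (parent ν) = parent (shift m ν) := by
  simp [shift, parent, add_sub_right_comm]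

theorem digit_shift (m : ℤ) (ν : Node) : digit (shift m ν) = digit ν := rfl

end Node

/-- The action on ports of adding digits. -/
def digitsMap (g : ℤ → ℕ) : Node × Letter → Option Bool → Option Bool
  | (_, a), p => p
  | (ν, b), p => p.map (xor · (g (ν.1 + 1)).bodd)
  | (ν, c), p => p.map (xor · (g ν.1).bodd)

/-- A port `some x` at `b` names a child, so its digit changes as on the next level; at `c` it is
compared with the node's own digit. -/
theorem basePort_digitsMap {g : ℤ → ℕ} (hg : ∀ n, g n = (g (n + 1)).div2) (v : Node × Letter)
    (p : Option Bool) :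
    basePort ((addDigits g v.1, v.2), digitsMap g v p) =
      ((addDigits g (basePort (v, p)).1.1, (basePort (v, p)).1.2),
        digitsMap g (basePort (v, p)).1 (basePort (v, p)).2) := by
  rcases v with ⟨ν, _ | _ | _⟩ <;> rcases p with _ | x
  · rfl
  · cases x <;> rfl
  · rfl
  · simp only [digitsMap, basePort, Option.map_some, addDigits_child hg]
    rfl
  · rfl
  · by_cases h : x = digit ν
    · simp only [digitsMap, basePort, Option.map_some, digit_addDigits hg, h, if_true,
        parent_addDigits hg]
      rw [show (parent ν).1 + 1 = ν.1 from sub_add_cancel _ _]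
    · simp [digitsMap, basePort, digit_addDigits hg, h]

theorem basePort_shift (m : ℤ) (v : Node × Letter) (p : Option Bool) :
    basePort ((shift m v.1, v.2), p) =
      ((shift m (basePort (v, p)).1.1, (basePort (v, p)).1.2), (basePort (v, p)).2) := by
  rcases v with ⟨ν, _ | _ | _⟩ <;> rcases p with _ | x
  · rfl
  · cases x <;> rfl
  · rfl
  · simp only [basePort, shift_child]
  · rfl
  · by_cases h : x = digit ν
    · simp only [basePort, digit_shift, h, if_true, shift_parent]
    · simp only [basePort, digit_shift, h, if_false]

/-! ### The quasitree -/

/-- The twists of the three kinds of vertices. -/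
def letterTwist : Letter → ZMod 2 × ZMod 3
  | a => (1, 0)
  | b => (0, 1)
  | c => 0

/-- The quasitree. -/
abbrev quasitree : SerreGraph := twist base fun v => letterTwist v.2

/-- The node below a vertex of the quasitree. -/
def vertexNode : quasitree.V → Node
  | core v _ => v.1
  | hub v _ => v.1

/-- The node below the initial vertex, or the hub, of an edge of the quasitree. -/
def edgeNode : quasitree.E → Node
  | link e _ => e.1.1.1
  | spoke v _ _ _ => v.1

theorem exists_aut_addDigits {g : ℤ → ℕ} (hg : ∀ n, g n = (g (n + 1)).div2) :
    ∃ γ : quasitree.Aut, (∀ v, vertexNode ((autHom γ).onV v) = addDigits g (vertexNode v)) ∧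
      ∀ e, edgeNode ((autHom γ).onE e) = addDigits g (edgeNode e) := by
  let f : Hom base base := ofPortsMap _ _ (basePort_digitsMap hg)
  let F : Hom quasitree quasitree := twistMap f (AddMonoidHom.id _) fun _ => rfl
  have hV : ∀ v, f.onV (f.onV v) = v := fun v => Prod.ext (addDigits_addDigits g v.1) rfl
  have hE : ∀ e, f.onE (f.onE e) = e := by
    rintro ⟨⟨⟨ν, _ | _ | _⟩, p⟩, j⟩
    all_goals
      refine Prod.ext (Prod.ext (hV _) ?_) rfl
      cases p <;> simp [f, ofPortsMap, digitsMap, addDigits]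
  have hFV : ∀ v, F.onV (F.onV v) = v
    | core v x => congrArg (core · x) (hV v)
    | hub v x => congrArg (hub · x) (hV v)
  have hFE : ∀ e, F.onE (F.onE e) = e
    | link e x => congrArg (link · x) (hE e)
    | spoke v x s j => congrArg (spoke · x s j) (hV v)
  refine ⟨autOfInverse F F hFV hFV hFE hFE, ?_, ?_⟩
  · rintro (_ | _) <;> rfl
  · rintro (_ | _) <;> rfl

theorem exists_aut_shift (m : ℤ) :
    ∃ γ : quasitree.Aut, (∀ v, vertexNode ((autHom γ).onV v) = shift m (vertexNode v)) ∧
      ∀ e, edgeNode ((autHom γ).onE e) = shift m (edgeNode e) := by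
  let f (m : ℤ) : Hom base base :=
    ofPortsMap (fun v => (shift m v.1, v.2)) (fun _ p => p) (basePort_shift m)
  let F (m : ℤ) : Hom quasitree quasitree := twistMap (f m) (AddMonoidHom.id _) fun _ => rfl
  have hs : ∀ m n, m + n = 0 → ∀ ν, shift m (shift n ν) = ν := fun m n h ν =>
    Prod.ext (by simp only [shift]; omega) rfl
  have hV : ∀ m n, m + n = 0 → ∀ v, (f m).onV ((f n).onV v) = v := fun m n h v =>
    Prod.ext (hs m n h v.1) rfl
  have hE : ∀ m n, m + n = 0 → ∀ e, (f m).onE ((f n).onE e) = e := fun m n h e =>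
    Prod.ext (Prod.ext (hV m n h e.1.1) rfl) rfl
  have hFV : ∀ m n, m + n = 0 → ∀ v, (F m).onV ((F n).onV v) = v := by
    rintro m n h (⟨v, x⟩ | ⟨v, x⟩)
    · exact congrArg (core · x) (hV m n h v)
    · exact congrArg (hub · x) (hV m n h v)
  have hFE : ∀ m n, m + n = 0 → ∀ e, (F m).onE ((F n).onE e) = e := by
    rintro m n h (⟨e, x⟩ | ⟨v, x, s, j⟩)
    · exact congrArg (link · x) (hE m n h e)
    · exact congrArg (spoke · x s j) (hV m n h v)
  have h1 := neg_add_cancel m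
  have h2 := add_neg_cancel m
  refine ⟨autOfInverse (F m) (F (-m)) (hFV _ _ h1) (hFV _ _ h2) (hFE _ _ h1) (hFE _ _ h2), ?_, ?_⟩
  · rintro (_ | _) <;> rfl
  · rintro (_ | _) <;> rfl

/-- Adding the digits of `ν` to itself clears them, and a shift then corrects the level. So all
nodes are equivalent, which gives cocompactness. -/
theorem exists_aut_node (ν : Node) :
    ∃ γ : quasitree.Aut, (∀ v, vertexNode v = ν → vertexNode ((autHom γ).onV v) = (0, 0)) ∧
      ∀ e, edgeNode e = ν → edgeNode ((autHom γ).onE e) = (0, 0) := by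
  obtain ⟨g, hg, hgν⟩ := exists_digits ν.1 ν.2
  obtain ⟨γ, hV, hE⟩ := exists_aut_addDigits hg
  obtain ⟨δ, hV', hE'⟩ := exists_aut_shift (-ν.1)
  have key : shift (-ν.1) (addDigits g ν) = (0, 0) := by simp [shift, addDigits, hgν]
  refine ⟨δ * γ, ?_, ?_⟩
  · rintro v rfl
    exact (hV' _).trans ((congrArg _ (hV v)).trans key)
  · rintro e rfl
    exact (hE' _).trans ((congrArg _ (hE e)).trans key)

theorem finite_orbits {G X : Type} [Group G] [MulAction G X] {S : Set X} (hS : S.Finite)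
    (h : ∀ x, ∃ g : G, g • x ∈ S) : Finite (MulAction.orbitRel.Quotient G X) := by
  have := hS.to_subtype
  refine Finite.of_surjective
    (fun s : S => (Quotient.mk'' s.1 : MulAction.orbitRel.Quotient G X)) fun q => ?_
  induction q using Quotient.inductionOn' with
  | h x =>
    obtain ⟨g, hg⟩ := h x
    exact ⟨⟨_, hg⟩, Quotient.sound' (s₁ := MulAction.orbitRel G X) ⟨g, rfl⟩⟩

theorem isCocompact_of_finite {X : SerreGraph} {S : Set X.V} {T : Set X.E} (hS : S.Finite)
    (hT : T.Finite) (hV : ∀ v, ∃ γ : X.Aut, (autHom γ).onV v ∈ S)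
    (hE : ∀ e, ∃ γ : X.Aut, (autHom γ).onE e ∈ T) : X.IsCocompact := by
  constructor
  · refine finite_orbits hS fun v => ?_
    obtain ⟨γ, hγ⟩ := hV v
    exact ⟨⟨γ, trivial⟩, hγ⟩
  · refine finite_orbits hT fun e => ?_
    obtain ⟨γ, hγ⟩ := hE e
    exact ⟨⟨γ, trivial⟩, hγ⟩

theorem quasitree_isCocompact : quasitree.IsCocompact := by
  refine isCocompact_of_finite (S := {v | vertexNode v = (0, 0)})
    (T := {e | edgeNode e = (0, 0)}) ?_ ?_ (fun v => ?_) fun e => ?_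
  · refine ((Set.finite_range fun p : Letter × ZMod 2 × ZMod 3 => core ((0, 0), p.1) p.2).union
      (Set.finite_range fun p : Letter × ZMod 2 × ZMod 3 => hub ((0, 0), p.1) p.2)).subset ?_
    rintro (⟨⟨ν, t⟩, f⟩ | ⟨⟨ν, t⟩, f⟩) h
    · obtain rfl : ν = (0, 0) := h
      exact .inl ⟨(t, f), rfl⟩
    · obtain rfl : ν = (0, 0) := h
      exact .inr ⟨(t, f), rfl⟩
  · refine ((Set.finite_range fun p : Letter × Option Bool × Bool × ZMod 2 × ZMod 3 =>
        link ((((0, 0), p.1), p.2.1), p.2.2.1) p.2.2.2).union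
      (Set.finite_range fun p : Letter × (ZMod 2 × ZMod 3) × Fin 3 × Bool =>
        spoke ((0, 0), p.1) p.2.1 p.2.2.1 p.2.2.2)).subset ?_
    rintro (⟨⟨⟨⟨ν, t⟩, p⟩, j⟩, f⟩ | ⟨⟨ν, t⟩, f, s, j⟩) h
    · obtain rfl : ν = (0, 0) := h
      exact .inl ⟨(t, p, j, f), rfl⟩
    · obtain rfl : ν = (0, 0) := h
      exact .inr ⟨(t, f, s, j), rfl⟩
  · obtain ⟨γ, hγ, -⟩ := exists_aut_node (vertexNode v)
    exact ⟨γ, hγ v rfl⟩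
  · obtain ⟨γ, -, hγ⟩ := exists_aut_node (edgeNode e)
    exact ⟨γ, hγ e rfl⟩

/-! ### The tree of nodes -/

/-- The tree of nodes. -/
def nodeTree : SimpleGraph Node where
  Adj ν μ := ν = parent μ ∨ μ = parent ν
  symm := ⟨fun _ _ h => h.symm⟩
  loopless := ⟨fun ν h => by
    have : ν.1 = ν.1 - 1 := congrArg Prod.fst (or_self_iff.mp h)
    omega⟩

theorem nodeTree_adj_parent (ν : Node) : nodeTree.Adj ν (parent ν) := .inr rfl

/-- Taking parents halves the second coordinate until it is zero, and the nodes `(n, 0)` form a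
line. -/
theorem nodeTree_connected : nodeTree.Connected := by
  have hup : ∀ n : ℤ, nodeTree.Reachable (n, 0) (n - 1, 0) := fun n =>
    SimpleGraph.Adj.reachable (.inr (by simp [parent]))
  have h0 : ∀ n : ℤ, nodeTree.Reachable (n, 0) (0, 0) := by
    intro n
    induction n using Int.induction_on with
    | zero => rfl
    | succ n ih =>
      have := hup (n + 1)
      rw [add_sub_cancel_right] at this
      exact this.trans ih
    | pred n ih => exact (hup _).symm.trans ih
  have h : ∀ (k : ℕ) (n : ℤ), nodeTree.Reachable (n, k) (0, 0) := by
    intro k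
    induction k using Nat.strong_induction_on with
    | _ k ih =>
      intro n
      rcases Nat.eq_zero_or_pos k with rfl | hk
      · exact h0 n
      · refine (nodeTree_adj_parent (n, k)).reachable.trans (ih _ ?_ _)
        rw [Nat.div2_val]
        omega
  exact ⟨fun ν μ => (h ν.2 ν.1).trans (h μ.2 μ.1).symm⟩

theorem nodeTree_isTree : nodeTree.IsTree := by
  refine ⟨nodeTree_connected, SimpleGraph.isAcyclic_iff_forall_adj_isBridge.mpr ?_⟩
  have key : ∀ ν, nodeTree.IsBridge s(ν, parent ν) := by
    intro ν
    rw [SimpleGraph.isBridge_iff]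
    rintro ⟨p⟩
    -- Without the edge from `ν` to its parent, no walk leaves the set of descendants of `ν`; the
    -- parent is not among them because its level is too low.
    have hdesc : ∀ {μ ρ : Node}, (nodeTree.deleteEdges {s(ν, parent ν)}).Walk μ ρ →
        (∃ j, parent^[j] μ = ν) → ∃ j, parent^[j] ρ = ν := by
      intro μ ρ p
      induction p with
      | nil => exact id
      | @cons u v _ h _ ih =>
        rintro ⟨j, hj⟩
        apply ih
        rw [SimpleGraph.deleteEdges_adj] at h
        obtain ⟨h | h, hne⟩ := h
        · exact ⟨j + 1, by rw [Function.iterate_succ_apply, ← h, hj]⟩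
        · rcases j with _ | j
          · obtain rfl : u = ν := hj
            exact absurd (by rw [h]; rfl) hne
          · exact ⟨j, by rw [h, ← Function.iterate_succ_apply, hj]⟩
    obtain ⟨j, hj⟩ := hdesc p ⟨0, rfl⟩
    have hlev : ∀ (j : ℕ) (μ : Node), (parent^[j] μ).1 = μ.1 - j := by
      intro j
      induction j with
      | zero => simp
      | succ j ih =>
        intro μ
        rw [Function.iterate_succ_apply, ih]
        simp only [parent]
        push_cast
        ring
    have h1 := hlev j (parent ν)
    rw [hj] at h1
    simp only [parent] at h1
    omega
  rintro ν μ (h | h)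
  · rw [h, Sym2.eq_swap]
    exact key μ
  · rw [h]
    exact key ν

/-! ### The quasi-isometry -/

/-- There is a path of length at most `n` from `x` to `y`. -/
def Near {V : Type} (G : SimpleGraph V) (n : ℕ) (x y : V) : Prop := ∃ p : G.Walk x y, p.length ≤ n

namespace Near

variable {V : Type} {G : SimpleGraph V} {m n : ℕ} {x y z : V}

theorem refl (x : V) : Near G n x x := ⟨.nil, Nat.zero_le _⟩

theorem symm (h : Near G n x y) : Near G n y x := by
  obtain ⟨p, hp⟩ := h
  exact ⟨p.reverse, by rwa [SimpleGraph.Walk.length_reverse]⟩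

theorem trans (h : Near G m x y) (h' : Near G n y z) : Near G (m + n) x z := by
  obtain ⟨p, hp⟩ := h
  obtain ⟨q, hq⟩ := h'
  exact ⟨p.append q, by rw [SimpleGraph.Walk.length_append]; omega⟩

theorem mono (h : Near G m x y) (hmn : m ≤ n) : Near G n x y :=
  h.imp fun _ hp => hp.trans hmn

theorem dist_le (h : Near G n x y) : G.dist x y ≤ n := by
  obtain ⟨p, hp⟩ := h
  exact (SimpleGraph.dist_le p).trans hp

end Near

theorem near_of_edge {X : SerreGraph} (e : X.E) : Near X.toSimple 1 (X.src e) (X.tgt e) := by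
  by_cases h : X.src e = X.tgt e
  · rw [← h]
    exact Near.refl _
  · exact ⟨.cons (show X.toSimple.Adj _ _ from ⟨h, e, rfl, rfl⟩) .nil, le_rfl⟩

theorem near_twist {F : Type} [AddCommGroup F] {Y : SerreGraph} {α : Y.V → F} (v : Y.V) (f : F) :
    Near (twist Y α).toSimple 1 (hub v f) (core v f) ∧
      Near (twist Y α).toSimple 2 (core v f) (core v (f + α v)) := by
  have h0 := near_of_edge (X := twist Y α) (spoke v f 0 false)
  have h1 := near_of_edge (X := twist Y α) (spoke v f 1 false)
  rw [twist_tgt_spoke] at h0 h1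
  simp only [spokeShift, if_true, add_zero, one_ne_zero, if_false] at h0 h1
  exact ⟨h0, h0.symm.trans h1⟩

theorem near_core_a_b (ν : Node) (f : ZMod 2 × ZMod 3) :
    Near quasitree.toSimple 1 (core (ν, a) f) (core (ν, b) f) :=
  near_of_edge (X := quasitree) (link (((ν, a), some false), true) f)

theorem near_core_a_c (ν : Node) (f : ZMod 2 × ZMod 3) :
    Near quasitree.toSimple 1 (core (ν, a) f) (core (ν, c) f) :=
  near_of_edge (X := quasitree) (link (((ν, a), some true), true) f)

/-- The second coordinate needs at most two increments, each of length 4 (to `b`, through a hub, and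
back); the first needs at most one, of length 2. -/
theorem near_core_a (ν : Node) (i : ZMod 2) (j : ZMod 3) :
    Near quasitree.toSimple 10 (core (ν, a) (i, j)) (core (ν, a) 0) := by
  have h1 : ∀ i j, Near quasitree.toSimple 2 (core (ν, a) (i, j)) (core (ν, a) (i + 1, j)) := by
    intro i j
    have := (near_twist (α := fun v : base.V => letterTwist v.2) (ν, a) (i, j)).2
    rwa [show (i, j) + letterTwist a = (i + 1, j) from Prod.ext rfl (add_zero j)] at this
  have h2 : ∀ i j, Near quasitree.toSimple 4 (core (ν, a) (i, j)) (core (ν, a) (i, j + 1)) := by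
    intro i j
    have := (near_twist (α := fun v : base.V => letterTwist v.2) (ν, b) (i, j)).2
    rw [show (i, j) + letterTwist b = (i, j + 1) from Prod.ext (add_zero i) rfl] at this
    exact ((near_core_a_b ν (i, j)).trans this).trans (near_core_a_b ν (i, j + 1)).symm
  have h3 : ∀ j, Near quasitree.toSimple 8 (core (ν, a) (0, j)) (core (ν, a) 0) := by
    intro j
    have hj : j = 0 ∨ j + 1 = 0 ∨ j + 1 + 1 = 0 := by
      revert j
      decide
    obtain rfl | hj | hj := hj
    · exact Near.refl _
    · have := h2 0 j
      rw [hj] at this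
      exact this.mono (by norm_num)
    · have := (h2 0 j).trans (h2 0 (j + 1))
      rwa [hj] at this
  have hi : i = 0 ∨ i + 1 = 0 := by
    revert i
    decide
  obtain rfl | hi := hi
  · exact (h3 j).mono (by norm_num)
  · have := h1 i j
    rw [hi] at this
    exact this.trans (h3 j)

theorem near_center (x : quasitree.V) :
    Near quasitree.toSimple 12 x (core (vertexNode x, a) 0) := by
  have hcore : ∀ ν t f, Near quasitree.toSimple 11 (core (ν, t) f) (core (ν, a) 0) := by
    rintro ν (_ | _ | _) f
    · exact (near_core_a ν f.1 f.2).mono (by norm_num)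
    · exact (near_core_a_b ν f).symm.trans (near_core_a ν f.1 f.2)
    · exact (near_core_a_c ν f).symm.trans (near_core_a ν f.1 f.2)
  rcases x with ⟨⟨ν, t⟩, f⟩ | ⟨⟨ν, t⟩, f⟩
  · exact (hcore ν t f).mono (by norm_num)
  · exact (near_twist (α := fun v : base.V => letterTwist v.2) (ν, t) f).1.trans (hcore ν t f)

theorem near_core_parent (ν : Node) :
    Near quasitree.toSimple 3 (core (ν, a) 0) (core (parent ν, a) 0) := by
  have h := near_of_edge (X := quasitree) (link (((ν, c), some (digit ν)), true) 0)
  rw [twist_tgt_link, ofPorts_tgt] at h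
  simp only [basePort, if_true] at h
  exact ((near_core_a_c ν 0).trans h).trans (near_core_a_b (parent ν) 0).symm

theorem near_core_of_walk {ν μ : Node} (p : nodeTree.Walk ν μ) :
    Near quasitree.toSimple (3 * p.length) (core (ν, a) 0) (core (μ, a) 0) := by
  induction p with
  | nil => exact Near.refl _
  | @cons u v _ h p ih =>
    have huv : Near quasitree.toSimple 3 (core (u, a) 0) (core (v, a) 0) := by
      rcases h with h | h
      · rw [h]
        exact (near_core_parent v).symm
      · rw [h]
        exact near_core_parent u
    refine (huv.trans ih).mono ?_
    rw [SimpleGraph.Walk.length_cons]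
    omega

/-- Each end is within 12 of the vertex `a` with zero fibre coordinate over its node, and a tree
edge lifts to a path of length 3 between such vertices. -/
theorem near_quasitree (x y : quasitree.V) :
    Near quasitree.toSimple (3 * nodeTree.dist (vertexNode x) (vertexNode y) + 24) x y := by
  obtain ⟨p, hp⟩ := nodeTree_connected.exists_walk_length_eq_dist (vertexNode x) (vertexNode y)
  refine (((near_center x).trans (near_core_of_walk p)).trans (near_center y).symm).mono ?_
  omega

theorem near_vertexNode (e : quasitree.E) :
    Near nodeTree 1 (vertexNode (quasitree.src e)) (vertexNode (quasitree.tgt e)) := by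
  rcases e with ⟨⟨⟨⟨ν, _ | _ | _⟩, p⟩, j⟩, f⟩ | ⟨v, f, s, j⟩
  · rcases p with _ | _ | _ <;> exact Near.refl ν
  · rcases p with _ | x
    · exact Near.refl ν
    · have h : nodeTree.Adj ν (child x ν) := .inl (parent_child x ν).symm
      exact ⟨.cons h .nil, le_rfl⟩
  · rcases p with _ | x
    · exact Near.refl ν
    · rw [twist_tgt_link, ofPorts_tgt]
      by_cases h : x = digit ν
      · simp only [basePort, if_pos h]
        exact ⟨.cons (nodeTree_adj_parent ν) .nil, le_rfl⟩
      · simp only [basePort, if_neg h]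
        exact Near.refl ν
  · cases j <;> exact Near.refl v.1

theorem near_vertexNode_of_walk {x y : quasitree.V} (p : quasitree.toSimple.Walk x y) :
    Near nodeTree p.length (vertexNode x) (vertexNode y) := by
  induction p with
  | nil => exact Near.refl _
  | @cons u v _ h p ih =>
    have huv : Near nodeTree 1 (vertexNode u) (vertexNode v) := by
      obtain ⟨-, e, rfl, rfl⟩ := h
      exact near_vertexNode e
    refine (huv.trans ih).mono ?_
    rw [SimpleGraph.Walk.length_cons, add_comm]

theorem quasitree_isQuasitree : quasitree.IsQuasitree := by
  have hconn : quasitree.toSimple.Connected := by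
    have : Nonempty quasitree.V := ⟨core ((0, 0), a) 0⟩
    exact ⟨fun x y => ⟨(near_quasitree x y).choose⟩⟩
  refine ⟨twist_locallyFinite ofPorts_locallyFinite, hconn, Node, nodeTree, nodeTree_isTree,
    vertexNode, 3, 24, by norm_num, by norm_num, fun x y => ⟨?_, ?_⟩, fun ν => ?_⟩
  · have h : (quasitree.toSimple.dist x y : ℝ) ≤
        3 * nodeTree.dist (vertexNode x) (vertexNode y) + 24 := by
      exact_mod_cast (near_quasitree x y).dist_le
    linarith
  · obtain ⟨p, hp⟩ := hconn.exists_walk_length_eq_dist x y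
    have h : (nodeTree.dist (vertexNode x) (vertexNode y) : ℝ) ≤ quasitree.toSimple.dist x y := by
      rw [← hp]
      exact_mod_cast (near_vertexNode_of_walk p).dist_le
    have h0 : (0 : ℝ) ≤ quasitree.toSimple.dist x y := Nat.cast_nonneg _
    linarith
  · refine ⟨core (ν, a) 0, ?_⟩
    rw [show vertexNode (core (ν, a) 0) = ν from rfl, SimpleGraph.dist_self]
    norm_num

/-! ### The two finite quotients -/

/-- The twists of the vertices of `left`. -/
def leftTwist (u : Option Bool) : ZMod 2 := if u = none then 1 else 0

/-- The twists of the vertices of `right`. -/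
def rightTwist (u : Option (ZMod 3)) : ZMod 3 := if u = none then 1 else 0

/-- The first finite quotient of the quasitree. -/
abbrev leftQuotient : SerreGraph := twist left leftTwist

/-- The second finite quotient of the quasitree. -/
abbrev rightQuotient : SerreGraph := twist right rightTwist

theorem leftQuotient_isFinite : leftQuotient.IsFinite := twist_isFinite ofPorts_isFinite

theorem rightQuotient_isFinite : rightQuotient.IsFinite := twist_isFinite ofPorts_isFinite

theorem quasitree_covers_leftQuotient : quasitree.Covers leftQuotient := by
  refine ⟨_, twistMap_isCovering baseToLeft_isCovering (φ := AddMonoidHom.fst (ZMod 2) (ZMod 3))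
    Prod.fst_surjective ?_⟩
  rintro ⟨ν, _ | _ | _⟩ <;> rfl

theorem quasitree_covers_rightQuotient : quasitree.Covers rightQuotient := by
  refine ⟨_, twistMap_isCovering baseToRight_isCovering (φ := AddMonoidHom.snd (ZMod 2) (ZMod 3))
    Prod.snd_surjective ?_⟩
  rintro ⟨ν, _ | _ | _⟩ <;> rfl

/-! ### Colours are visible in all quotients -/

/-- Multiplication by 3 kills the twists of `b` and `c` but not the twist of order 2 at `none`. The
vertex `b` over the same node has no other neighbour `a`. -/
theorem eq_none_iff_of_left {p : Hom quasitree leftQuotient} (hp : p.IsCovering)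
    {v : Node × Letter} {f : ZMod 2 × ZMod 3} {u : Option Bool} {i : ZMod 2}
    (h : p.onV (core v f) = core u i) : u = none ↔ v.2 = a := by
  refine onV_core_mem_iff (S := {v : base.V | v.2 = a}) (S' := {u : left.V | u = none}) hp
    ofPorts_locallyFinite ofPorts_exists_src ofPorts_locallyFinite ofPorts_exists_src 3 ?_ ?_ ?_ ?_ h
  · rintro ⟨ν, _ | _ | _⟩ hv
    · exact absurd rfl hv
    · change 3 • ((0, 1) : ZMod 2 × ZMod 3) = 0
      decide
    · exact smul_zero _
  · rintro u rfl
    change 3 • (1 : ZMod 2) ≠ 0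
    decide
  · rintro (_ | i) hu
    · exact absurd rfl hu
    · exact ⟨((some i, none), true), rfl, rfl⟩
  · rintro ⟨ν, t⟩ rfl
    refine ⟨(ν, b), show b ≠ a from nofun, ?_⟩
    rintro ⟨⟨w, _ | x⟩, j⟩ hw ht
    · obtain rfl : w = (ν, b) := hw
      rfl
    · obtain rfl : w = (ν, b) := hw
      exact nomatch ht

/-- Now multiplication by 2 kills the twists of `a` and `c` but not the twist of order 3. The only
neighbour `b` of `c` over a child lies over the parent. -/
theorem eq_none_iff_of_right {q : Hom quasitree rightQuotient} (hq : q.IsCovering)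
    {v : Node × Letter} {f : ZMod 2 × ZMod 3} {u : Option (ZMod 3)} {i : ZMod 3}
    (h : q.onV (core v f) = core u i) : u = none ↔ v.2 = b := by
  refine onV_core_mem_iff (S := {v : base.V | v.2 = b}) (S' := {u : right.V | u = none}) hq
    ofPorts_locallyFinite ofPorts_exists_src ofPorts_locallyFinite ofPorts_exists_src 2 ?_ ?_ ?_ ?_ h
  · rintro ⟨ν, _ | _ | _⟩ hv
    · change 2 • ((1, 0) : ZMod 2 × ZMod 3) = 0
      decide
    · exact absurd rfl hv
    · exact smul_zero _
  · rintro u rfl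
    change 2 • (1 : ZMod 3) ≠ 0
    decide
  · rintro (_ | i) hu
    · exact absurd rfl hu
    · exact ⟨((some i, 0), true), rfl, rfl⟩
  · rintro ⟨ν, t⟩ rfl
    refine ⟨(child false ν, c), show c ≠ b from nofun, ?_⟩
    rintro ⟨⟨w, _ | x⟩, j⟩ hw ht
    · obtain rfl : w = (child false ν, c) := hw
      exact nomatch ht
    · obtain rfl : w = (child false ν, c) := hw
      rw [ofPorts_tgt] at ht ⊢
      by_cases hx : x = digit (child false ν)
      · simp only [basePort, if_pos hx, parent_child]
      · simp only [basePort, if_neg hx] at ht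
        exact nomatch ht

/-- The colour of a vertex of the quasitree. -/
def vertexColor : quasitree.V → Option Letter
  | core v _ => some v.2
  | hub _ _ => none

/-- The colour of a vertex that can be recovered from its images in the two finite quotients. -/
def jointColor : leftQuotient.V → rightQuotient.V → Option Letter
  | core none _, _ => some a
  | core (some _) _, core none _ => some b
  | core (some _) _, core (some _) _ => some c
  | _, _ => none

/-- The coverings are arbitrary, not the ones constructed above. This independence of choices yields
both negative statements. -/
theorem jointColor_eq {p : Hom quasitree leftQuotient} (hp : p.IsCovering)
    {q : Hom quasitree rightQuotient} (hq : q.IsCovering) (x : quasitree.V) :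
    jointColor (p.onV x) (q.onV x) = vertexColor x := by
  rcases x with ⟨v, f⟩ | ⟨v, f⟩
  · obtain ⟨u, i, hu⟩ := exists_core hp ofPorts_locallyFinite ofPorts_exists_src v f
    obtain ⟨w, j, hw⟩ := exists_core hq ofPorts_locallyFinite ofPorts_exists_src v f
    have h1 := eq_none_iff_of_left hp hu
    have h2 := eq_none_iff_of_right hq hw
    rw [hu, hw]
    rcases v with ⟨ν, _ | _ | _⟩
    · obtain rfl := h1.mpr rfl
      rfl
    · obtain rfl := h2.mpr rfl
      rcases u with _ | u
      · exact nomatch h1.mp rfl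
      · rfl
    · rcases u with _ | u
      · exact nomatch h1.mp rfl
      · rcases w with _ | w
        · exact nomatch h2.mp rfl
        · rfl
  · obtain ⟨u, i, hu⟩ := exists_hub hp ofPorts_locallyFinite ofPorts_exists_src v f
    rw [hu]
    rfl

/-! ### The numbers of edges between the colour classes -/

/-- The letter of the neighbour at a port, in terms of the letter and the digit of the vertex. -/
def portLetter : Letter → Bool → Option Bool → Letter
  | a, _, none => a
  | a, _, some false => b
  | a, _, some true => c
  | b, _, none => a
  | b, _, some _ => c
  | c, _, none => a
  | c, y, some x => if x = y then b else c

theorem basePort_letter (v : Node × Letter) (p : Option Bool) :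
    (basePort (v, p)).1.2 = portLetter v.2 (digit v.1) p := by
  rcases v with ⟨ν, _ | _ | _⟩ <;> rcases p with _ | x
  · rfl
  · cases x <;> rfl
  · rfl
  · rfl
  · rfl
  · by_cases h : x = digit ν
    · simp only [basePort, portLetter, if_pos h]
    · simp only [basePort, portLetter, if_neg h]

theorem ncard_vertexColor {s t : Letter} {n : ℕ}
    (hn : ∀ y, (Finset.univ.filter fun p : Option Bool × Bool => portLetter s y p.1 = t).card = n)
    {x : quasitree.V} (hx : vertexColor x = some s) :
    {e | quasitree.src e = x ∧ vertexColor (quasitree.tgt e) = some t}.ncard = n := by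
  rcases x with ⟨v, f⟩ | ⟨v, f⟩
  · obtain rfl : v.2 = s := Option.some.inj hx
    let g : Option Bool × Bool → quasitree.E := fun p => link ((v, p.1), p.2) f
    have hg : Function.Injective g := by
      intro p p' h
      have := (TwistEdge.link.inj h).1
      simp only [Prod.mk.injEq, true_and] at this
      exact Prod.ext this.1 this.2
    have : {e | quasitree.src e = core v f ∧ vertexColor (quasitree.tgt e) = some t} =
        g '' (Finset.univ.filter fun p : Option Bool × Bool =>
          portLetter v.2 (digit v.1) p.1 = t : Finset _) := by
      ext e
      constructor
      · rintro ⟨he, ht⟩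
        rcases twist_src_eq_core he with ⟨⟨⟨w, p⟩, j⟩, hw, rfl⟩ | ⟨s, rfl⟩
        · obtain rfl : w = v := hw
          refine ⟨(p, j), ?_, rfl⟩
          simp only [Finset.coe_filter, Finset.mem_univ, true_and, Set.mem_ofPred_eq]
          rw [← basePort_letter]
          exact Option.some.inj ht
        · exact nomatch ht
      · rintro ⟨p, hp, rfl⟩
        simp only [Finset.coe_filter, Finset.mem_univ, true_and, Set.mem_ofPred_eq] at hp
        rw [← basePort_letter] at hp
        exact ⟨rfl, congrArg some hp⟩
    rw [this, Set.ncard_image_of_injective _ hg, Set.ncard_coe_finset, hn]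
  · exact nomatch hx

/-- There is no proper cocompact group action preserving a colouring with the same numbers of edges
between colour classes as in the quasitree. -/
theorem not_exists_invariant_color {Z : SerreGraph} (hl : Z.LocallyFinite) {Γ : Subgroup Z.Aut}
    (hp : ActsProperly Γ) (hc : ActsCocompactly Γ) {τ : Z.V → Option Letter}
    (hτ : ∀ (γ : Γ) v, τ (γ • v) = τ v) (hex : ∃ v, τ v = some a)
    (hcount : ∀ (s t : Letter) (n : ℕ), (∀ y, (Finset.univ.filter
      fun p : Option Bool × Bool => portLetter s y p.1 = t).card = n) → ∀ z, τ z = some s →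
        {e | Z.src e = z ∧ τ (Z.tgt e) = some t}.ncard = n) : False := by
  -- The first two relations make the three weights equal; the third makes the weight of `c` twice
  -- that of `b`.
  have hab := weight_mul_eq hl hp hc hτ (hcount a b 2 (by decide)) (hcount b a 2 (by decide))
  have hac := weight_mul_eq hl hp hc hτ (hcount a c 2 (by decide)) (hcount c a 2 (by decide))
  have hbc := weight_mul_eq hl hp hc hτ (hcount b c 4 (by decide)) (hcount c b 2 (by decide))
  have hpos := weight_pos hp hc hτ hex
  push_cast at hab hac hbc
  linarith

theorem not_isUniformLattice_of_color {X : SerreGraph} (hl : X.LocallyFinite)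
    {τ : X.V → Option Letter} (hτ : ∀ (γ : X.Aut) v, τ ((autHom γ).onV v) = τ v)
    (hex : ∃ v, τ v = some a)
    (hcount : ∀ (s t : Letter) (n : ℕ), (∀ y, (Finset.univ.filter
      fun p : Option Bool × Bool => portLetter s y p.1 = t).card = n) → ∀ z, τ z = some s →
        {e | X.src e = z ∧ τ (X.tgt e) = some t}.ncard = n) :
    ¬ ∃ Γ : Subgroup X.Aut, IsUniformLattice Γ := by
  rintro ⟨Γ, -, hp, hc⟩
  exact not_exists_invariant_color hl hp hc (fun γ v => hτ γ v) hex hcount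

theorem IsFinite.locallyFinite {Z : SerreGraph} (hZ : Z.IsFinite) : Z.LocallyFinite := fun _ =>
  have := hZ.2
  Set.toFinite _

theorem actsProperly_bot {Z : SerreGraph} : ActsProperly (⊥ : Subgroup Z.Aut) :=
  fun _ _ => Set.toFinite _

theorem IsFinite.actsCocompactly {Z : SerreGraph} (hZ : Z.IsFinite) (Γ : Subgroup Z.Aut) :
    ActsCocompactly Γ := by
  have := hZ.1
  have := hZ.2
  exact ⟨Quotient.finite _, Quotient.finite _⟩

theorem not_exists_common_quotient : ¬ ∃ Z : SerreGraph, Z.IsFinite ∧ quasitree.Covers Z ∧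
    Z.Covers leftQuotient ∧ Z.Covers rightQuotient := by
  rintro ⟨Z, hZ, ⟨ψ, hψ⟩, ⟨p, hp⟩, q, hq⟩
  have hjoint : ∀ x, jointColor (p.onV (ψ.onV x)) (q.onV (ψ.onV x)) = vertexColor x :=
    jointColor_eq (hp.comp hψ) (hq.comp hψ)
  -- The trivial group acts properly, and cocompactly because `Z` is finite.
  refine not_exists_invariant_color hZ.locallyFinite actsProperly_bot
    (hZ.actsCocompactly ⊥) (τ := fun z => jointColor (p.onV z) (q.onV z)) ?_ ?_ ?_
  · rintro ⟨γ, hγ⟩ v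
    obtain rfl := Subgroup.mem_bot.mp hγ
    rfl
  · exact ⟨ψ.onV (core ((0, 0), a) 0), hjoint _⟩
  · intro s t n hn z hz
    obtain ⟨x, rfl⟩ := hψ.1 z
    rw [ncard_star_color hψ (fun z => jointColor (p.onV z) (q.onV z))]
    simp only [hjoint]
    exact ncard_vertexColor hn ((hjoint x).symm.trans hz)

theorem not_exists_isUniformLattice_quasitree :
    ¬ ∃ Γ : Subgroup quasitree.Aut, IsUniformLattice Γ := by
  obtain ⟨p, hp⟩ := quasitree_covers_leftQuotient
  obtain ⟨q, hq⟩ := quasitree_covers_rightQuotient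
  refine not_isUniformLattice_of_color quasitree_isQuasitree.1 (τ := vertexColor) ?_
    ⟨core ((0, 0), a) 0, rfl⟩ fun s t n hn z hz => ncard_vertexColor hn hz
  intro γ v
  -- The colour of `γ • v` is read through `p` and `q`, that of `v` through `p` and `q` composed
  -- with `γ`; these readings agree by definition.
  rw [← jointColor_eq hp hq, ← jointColor_eq (hp.comp (autHom_isCovering γ))
    (hq.comp (autHom_isCovering γ))]
  rfl

end SerreGraph

theorem theorem4p2 :
    ∃ X X₁ X₂ : SerreGraph,
      X.IsQuasitree ∧ X.IsCocompact ∧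
      X₁.IsFinite ∧ X₂.IsFinite ∧
      X.Covers X₁ ∧ X.Covers X₂ ∧
      (¬ ∃ Xhat : SerreGraph, Xhat.IsFinite ∧ X.Covers Xhat ∧ Xhat.Covers X₁ ∧ Xhat.Covers X₂) ∧
      ¬ ∃ Γ : Subgroup X.Aut, SerreGraph.IsUniformLattice Γ :=
  ⟨SerreGraph.quasitree, SerreGraph.leftQuotient, SerreGraph.rightQuotient,
    SerreGraph.quasitree_isQuasitree, SerreGraph.quasitree_isCocompact,
    SerreGraph.leftQuotient_isFinite, SerreGraph.rightQuotient_isFinite,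
    SerreGraph.quasitree_covers_leftQuotient, SerreGraph.quasitree_covers_rightQuotient,
    SerreGraph.not_exists_common_quotient, SerreGraph.not_exists_isUniformLattice_quasitree⟩
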